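/- **Setting.** Let $\mathcal C$ and $\mathcal Y\neq\emptyset$ be finite sets (information items and Receiver responses), $m=|\mathcal Y|$, let $\mu$ be a prior on $\mathcal C$ with $\mu_c>0$ for all $c$, and let $u,v:\mathcal C\times\mathcal Y\to\mathbb R$ be the utilities of the Receiver and of the Advisor, with $|v(c,y)|\le B$ for all $c,y$. A direct signaling scheme is a map $\phi:\mathcal C\to\Delta(\mathcal Y)$. It is persuasive if every response $y$ that is recommended with positive probability maximizes the Receiver's expected utility under the posterior $\Pr(c\mid y)=\mu_c\phi_c(y)/\sum_{c'}\mu_{c'}\phi_{c'}(y)$. Let $\mathcal P$ be the set of direct, persuasive schemes, and put $$v(\phi)=\sum_{c\in\mathcal C}\sum_{y\in\mathcal Y}\mu_c\phi_c(y)v(c,y),\qquad f(\phi)=\Big[-\sum_{c\in\mathcal C}\mu_c\phi_c(y)v(c,y)\Big]_{y\in\mathcal Y}\in\mathbb R^{\mathcal Y}.$$ **Regret minimizers.** A recommender $\mathcal R$ for a set $X\subseteq\mathbb R^{\mathcal Y}$ chooses in every round, possibly at random, a point $z_t\in X$ depending on its earlier recommendations and on the scalar feedback received after each of them. It is a regret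 minimizer with bound $\rho$ if the following holds for every sequence of linear functions $g_1,g_2,\dots$ (not revealed to it) and every feedback rule which, after $z_t$ is played, returns one random number (of discrete law depending only on $t$ and $z_t$) in $[-B,B]$ with mean $g_t(z_t)$: for all $T\ge2$ and $x\in X$, $\ \sum_{t\le T}g_t(x)-\mathbb E\sum_{t\le T}g_t(z_t)\le\rho(T)$. **Algorithm.** Given a recommender $\mathcal R$ for the convex hull $\mathrm{co}\,f(\mathcal P)$, in each round $t=1,\dots,T$: $\mathcal R$ recommends $z_t\in\mathrm{co}\,f(\mathcal P)$; a decomposition subroutine writes $z_t=\sum_{i=1}^{m+1}\lambda_t^{(i)}f(\phi_t^{(i)})$ with $\phi_t^{(i)}\in\mathcal P$ and convex weights $\lambda_t^{(i)}$; an index $i_t$ is drawn with these weights and $\phi_t=\phi_t^{(i_t)}$; an item $c_t\sim\mu$ is observed and a response $y_t\sim\phi_t(\cdot\mid c_t)$ is played; $\mathcal R$ observes the number $v(c_t,y_t)$. The Advisor's regret is $R_T=\max_{\phi\in\mathcal P}\sum_{t=1}^Tv(\phi)-\sum_{t=1}^Tv(\phi_t)$. **Theorem.** There is an absolute constant $K>0$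 such that in every such setting the maximum of $v$ over $\mathcal P$ is attained, a decomposition subroutine exists (Carathéodory), and there is a regret minimizer $\mathcal R$ for $\mathrm{co}\,f(\mathcal P)$ with bound $\rho(T)=K\,B\,m^{3/2}\sqrt{T\log T}$ for which, with every decomposition subroutine and for every $T\ge2$, the algorithm guarantees $$\mathbb E[R_T]\le K\,B\,m^{3/2}\sqrt{T\log T}.$$ In particular $\mathbb E[R_T]=O(m^{3/2}\sqrt{T\log T})$ for utilities $v$ bounded by a constant. -/

import Mathlib

noncomputable section

/-- Expectation of a real function under a discrete probability distribution. -/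
def pmfExpect {α : Type*} (p : PMF α) (F : α → ℝ) : ℝ :=
  ∑' a, (p a).toReal * F a

/-! ### Regret minimizers with scalar (bandit) feedback -/

/-- A (randomized) online decision maker on the set `X`.  `recommend h` is the law of the next
recommended point, given the history `h` of the decision maker's earlier recommendations and of
the scalar feedback observed after each of them (most recent round first). -/
structure Recommender {E : Type*} (X : Set E) where
  recommend : List (X × ℝ) → PMF X

/-- An (oblivious) environment: in round `t` there is a linear payoff function `payoff t`, not
revealed to the decision maker.  After the decision maker plays `z`, it observes only one number,
drawn from `feedback t z`, which lies in `[-B, B]` and has mean `payoff t z`.  Noiseless bandit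
feedback is the case in which `feedback t z` is a point mass at `payoff t z`. -/
structure BanditEnvironment {E : Type*} [AddCommGroup E] [Module ℝ E] (X : Set E) (B : ℝ) where
  payoff : ℕ → E →ₗ[ℝ] ℝ
  feedback : ℕ → X → PMF ℝ
  bounded : ∀ t z, ∀ r ∈ (feedback t z).support, |r| ≤ B
  unbiased : ∀ t (z : X), pmfExpect (feedback t z) id = payoff t z

namespace BanditEnvironment

variable {E : Type*} [AddCommGroup E] [Module ℝ E] {X : Set E} {B : ℝ}

/-- Law of the history after `n` rounds (most recent round first). -/
def play (env : BanditEnvironment X B) (R : Recommender X) : ℕ → PMF (List (X × ℝ))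
  | 0 => PMF.pure []
  | n + 1 => (env.play R n).bind fun h =>
      (R.recommend h).bind fun z =>
        (env.feedback n z).bind fun r => PMF.pure ((z, r) :: h)

/-- The cumulative payoff `∑ₜ payoff t (zₜ)` of the points played along a history. -/
def cumPayoff (env : BanditEnvironment X B) : List (X × ℝ) → ℝ
  | [] => 0
  | (z, _) :: h => env.payoff h.length (z : E) + env.cumPayoff h

end BanditEnvironment

/-- `R` is a regret minimizer for `X` with regret bound `ρ`: against every environment with
unknown linear payoffs and feedback in `[-B, B]`, and for every horizon `T ≥ 2`, its expected
regret against every fixed point of `X` is at most `ρ T`. -/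
def Recommender.IsRegretMinimizer {E : Type*} [AddCommGroup E] [Module ℝ E] {X : Set E}
    (R : Recommender X) (B : ℝ) (ρ : ℕ → ℝ) : Prop :=
  ∀ env : BanditEnvironment X B, ∀ T : ℕ, 2 ≤ T → ∀ x ∈ X,
    ∑ t ∈ Finset.range T, env.payoff t x - pmfExpect (env.play R T) env.cumPayoff ≤ ρ T

/-! ### Bayesian persuasion -/

/-- A persuasion problem with information items `C` and responses `Y`: a common prior in the
interior of the simplex, the Receiver's utility `u` and the Advisor's utility `v`. -/
structure PersuasionProblem (C Y : Type*) where
  prior : PMF C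
  prior_pos : ∀ c, 0 < prior c
  u : C → Y → ℝ
  v : C → Y → ℝ

/-- A direct signaling scheme: every information item is mapped to a distribution over
recommended responses. -/
abbrev DirectScheme (C Y : Type*) := C → PMF Y

namespace PersuasionProblem

variable {C Y : Type*} [Fintype C] [Fintype Y] (I : PersuasionProblem C Y)

/-- The probability that the scheme `φ` sends the recommendation `y`. -/
def signalProb (φ : DirectScheme C Y) (y : Y) : ℝ :=
  ∑ c, (I.prior c).toReal * (φ c y).toReal

/-- The posterior probability of the item `c` given the recommendation `y` (Bayes' rule). -/
def posterior (φ : DirectScheme C Y) (y : Y) (c : C) : ℝ :=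
  (I.prior c).toReal * (φ c y).toReal / I.signalProb φ y

/-- The Receiver's optimal responses under the belief `b` over information items. -/
def bestResponses (b : C → ℝ) : Set Y :=
  {y | ∀ y', ∑ c, b c * I.u c y' ≤ ∑ c, b c * I.u c y}

/-- The set `𝒫` of direct and persuasive schemes: following any recommendation that is sent with
positive probability is optimal for the Receiver under its posterior belief. -/
def persuasiveSchemes : Set (DirectScheme C Y) :=
  {φ | ∀ y, 0 < I.signalProb φ y → y ∈ I.bestResponses (I.posterior φ y)}

/-- The Advisor's expected utility `v(φ)`. -/
def advisorUtility (φ : DirectScheme C Y) : ℝ :=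
  ∑ c, ∑ y, (I.prior c).toReal * (φ c y).toReal * I.v c y

/-- The linear map `(φ_c(y))_{c,y} ↦ [-∑ c, μ_c φ_c(y) v(c,y)]_y`. -/
def embedLinear : (C → Y → ℝ) →ₗ[ℝ] (Y → ℝ) where
  toFun w := fun y => -∑ c, (I.prior c).toReal * w c y * I.v c y
  map_add' w w' := by
    funext y
    simp only [Pi.add_apply, mul_add, add_mul, Finset.sum_add_distrib]
    ring
  map_smul' a w := by
    funext y
    simp only [Pi.smul_apply, smul_eq_mul, RingHom.id_apply, mul_neg, Finset.mul_sum]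
    congr 1
    exact Finset.sum_congr rfl fun c _ => by ring

/-- `f(φ) = [-v(φ, y)]_y`. -/
def embed (φ : DirectScheme C Y) : Y → ℝ :=
  I.embedLinear fun c y => (φ c y).toReal

/-- The set `co f(𝒫)`. -/
def hull : Set (Y → ℝ) :=
  convexHull ℝ (I.embed '' I.persuasiveSchemes)

/-- A subroutine DECOMPOSE: it writes every `z ∈ co f(𝒫)` as a convex combination of the images
of `m + 1` direct and persuasive schemes, `m` being the number of responses. -/
structure Decomposition where
  scheme : I.hull → Fin (Fintype.card Y + 1) → I.persuasiveSchemes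
  weight : I.hull → PMF (Fin (Fintype.card Y + 1))
  combine : ∀ z : I.hull,
    ∑ i, (weight z i).toReal • I.embed (scheme z i : DirectScheme C Y) = (z : Y → ℝ)

/-- What happens in one round: the recommended point, the sampled scheme, the realized
information item and the realized response. -/
structure Round where
  point : I.hull
  scheme : I.persuasiveSchemes
  item : C
  response : Y

/-- What the regret minimizer has seen of a history: its own recommendations and the realized
utilities `v(cₜ, yₜ)`. -/
def observed (h : List I.Round) : List (I.hull × ℝ) :=
  h.map fun r => (r.point, I.v r.item r.response)

/-- The persuasion algorithm with the regret minimizer `R` and the subroutine `D`: the law of the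
history after `n` rounds (most recent round first).  In each round `zₜ` is recommended by `R`,
an index is drawn with the weights of the decomposition of `zₜ`, the scheme with this index is
used, the item is drawn from the prior, and the response from the scheme given the item. -/
def run (R : Recommender I.hull) (D : I.Decomposition) : ℕ → PMF (List I.Round)
  | 0 => PMF.pure []
  | n + 1 => (run R D n).bind fun h =>
      (R.recommend (I.observed h)).bind fun z =>
        (D.weight z).bind fun i =>
          I.prior.bind fun c =>
            ((D.scheme z i : DirectScheme C Y) c).bind fun y =>
              PMF.pure (⟨z, D.scheme z i, c, y⟩ :: h)

/-- The regret `R_T = max_{φ ∈ 𝒫} ∑ₜ v(φ) - ∑ₜ v(φₜ)` along a history of `T` rounds. -/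
def regret (T : ℕ) (h : List I.Round) : ℝ :=
  sSup ((fun φ => ∑ _t ∈ Finset.range T, I.advisorUtility φ) '' I.persuasiveSchemes) -
    (h.map fun r => I.advisorUtility (r.scheme : DirectScheme C Y)).sum

/-- The expected regret of the algorithm after `T` rounds. -/
def expectedRegret (R : Recommender I.hull) (D : I.Decomposition) (T : ℕ) : ℝ :=
  pmfExpect (I.run R D T) (I.regret T)

end PersuasionProblem

end

/-!
Seen from its recommender, the persuasion algorithm is a bandit environment with the fixed linear
payoff `z ↦ -∑ y, z y` on `co f(𝒫)`, because the realized utility `v(cₜ, yₜ)` has conditional mean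
`v(φₜ)` averaged over the decomposition of `zₜ`. Hence the Advisor's regret is the regret of the
recommender, and it remains to bound regret for linear payoffs on a compact set `X` of dimension
`d ≤ m` with scalar feedback.

The recommender runs exponential weights over a countable subset of `X`, mixed with exploration of
a barycentric spanner. In the coordinates of the spanner the payoff is estimated by least squares
from the scalar feedback, and the variance of the estimates is paid for by a factor `d`. The prior
spreads its mass over finite nets of `X` at all dyadic scales at once: a point within `δ` of any
comparator is charged about `δ ^ d`, so the entropy term is of order `d log T` although the horizon
is unknown, and decreasing learning rates of order `√(log t / t)` turn this into the bound
`d ^ (3 / 2) √(T log T)`.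
-/

noncomputable section

/-! ### Expectations under discrete distributions -/

section Expectation

variable {α β ι : Type*}

/-- The function `F` is bounded on the support of the discrete distribution `p`. -/
@[fun_prop]
def BoundedOnSupport (F : α → ℝ) (p : PMF α) : Prop := ∃ M, ∀ a ∈ p.support, |F a| ≤ M

namespace BoundedOnSupport
variable {p : PMF α} {F G : α → ℝ}

@[fun_prop]
theorem const (c : ℝ) : BoundedOnSupport (fun _ => c) p := ⟨|c|, fun _ _ => le_rfl⟩

@[fun_prop]
theorem add (hF : BoundedOnSupport F p) (hG : BoundedOnSupport G p) :
    BoundedOnSupport (fun a => F a + G a) p := by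
  obtain ⟨M, hM⟩ := hF
  obtain ⟨N, hN⟩ := hG
  exact ⟨M + N, fun a ha => (abs_add_le _ _).trans (add_le_add (hM a ha) (hN a ha))⟩

@[fun_prop]
theorem mul (hF : BoundedOnSupport F p) (hG : BoundedOnSupport G p) :
    BoundedOnSupport (fun a => F a * G a) p := by
  obtain ⟨M, hM⟩ := hF
  obtain ⟨N, hN⟩ := hG
  refine ⟨M * N, fun a ha => ?_⟩
  rw [abs_mul]
  exact mul_le_mul (hM a ha) (hN a ha) (abs_nonneg _) ((abs_nonneg _).trans (hM a ha))

@[fun_prop]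
theorem pow (hF : BoundedOnSupport F p) (n : ℕ) : BoundedOnSupport (fun a => F a ^ n) p := by
  induction n with
  | zero => simpa using const (p := p) 1
  | succ n ih => simpa only [pow_succ] using ih.mul hF

@[fun_prop]
theorem sum {s : Finset ι} {F : ι → α → ℝ}
    (hF : ∀ i, BoundedOnSupport (F i) p) : BoundedOnSupport (fun a => ∑ i ∈ s, F i a) p := by
  classical
  induction s using Finset.induction_on with
  | empty => simpa using const (p := p) 0
  | insert i s hi ih =>
    simp only [Finset.sum_insert hi]
    exact (hF i).add ih

@[fun_prop]
theorem exp (hF : BoundedOnSupport F p) : BoundedOnSupport (fun a => Real.exp (F a)) p := by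
  obtain ⟨M, hM⟩ := hF
  refine ⟨Real.exp M, fun a ha => ?_⟩
  rw [Real.abs_exp]
  exact Real.exp_le_exp.2 ((le_abs_self _).trans (hM a ha))

@[fun_prop]
theorem dotProduct [Fintype ι] {f : α → ι → ℝ} {g : α → ι → ℝ}
    (hf : ∀ i, BoundedOnSupport (fun x => f x i) p)
    (hg : ∀ i, BoundedOnSupport (fun x => g x i) p) :
    BoundedOnSupport (fun x => f x ⬝ᵥ g x) p := sum fun i => (hf i).mul (hg i)

end BoundedOnSupport

section

variable {p : PMF α} {F G : α → ℝ}

theorem tsum_toReal_pmf (p : PMF α) : ∑' a, (p a).toReal = 1 := by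
  rw [← ENNReal.tsum_toReal_eq p.apply_ne_top, p.tsum_coe, ENNReal.toReal_one]

theorem summable_toReal_pmf (p : PMF α) : Summable fun a => (p a).toReal :=
  ENNReal.summable_toReal p.tsum_coe_ne_top

theorem toReal_pmf_eq_zero_of_notMem {a : α} (h : a ∉ p.support) : (p a).toReal = 0 := by
  rw [(p.apply_eq_zero_iff a).2 h, ENNReal.toReal_zero]

theorem BoundedOnSupport.summable (hF : BoundedOnSupport F p) :
    Summable fun a => (p a).toReal * F a := by
  obtain ⟨M, hM⟩ := hF
  refine Summable.of_norm_bounded ((summable_toReal_pmf p).mul_right M) fun a => ?_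
  rw [norm_mul, Real.norm_of_nonneg ENNReal.toReal_nonneg, Real.norm_eq_abs]
  by_cases ha : a ∈ p.support
  · exact mul_le_mul_of_nonneg_left (hM a ha) ENNReal.toReal_nonneg
  · simp [toReal_pmf_eq_zero_of_notMem ha]

theorem pmfExpect_const (p : PMF α) (c : ℝ) : pmfExpect p (fun _ => c) = c := by
  rw [pmfExpect, tsum_mul_right, tsum_toReal_pmf, one_mul]

theorem pmfExpect_add (hF : BoundedOnSupport F p) (hG : BoundedOnSupport G p) :
    pmfExpect p (fun a => F a + G a) = pmfExpect p F + pmfExpect p G := by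
  simp only [pmfExpect, mul_add]
  exact hF.summable.tsum_add hG.summable

theorem pmfExpect_const_mul (p : PMF α) (c : ℝ) (F : α → ℝ) :
    pmfExpect p (fun a => c * F a) = c * pmfExpect p F := by
  simp only [pmfExpect, mul_left_comm _ c, tsum_mul_left]

theorem pmfExpect_sub (hF : BoundedOnSupport F p) (hG : BoundedOnSupport G p) :
    pmfExpect p (fun a => F a - G a) = pmfExpect p F - pmfExpect p G := by
  simp only [pmfExpect, mul_sub]
  exact hF.summable.tsum_sub hG.summable

theorem pmfExpect_sum {s : Finset ι} {F : ι → α → ℝ} (hF : ∀ i, BoundedOnSupport (F i) p) :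
    pmfExpect p (fun a => ∑ i ∈ s, F i a) = ∑ i ∈ s, pmfExpect p (F i) := by
  simp only [pmfExpect, Finset.mul_sum]
  exact Summable.tsum_finsetSum fun i _ => (hF i).summable

theorem pmfExpect_congr (h : ∀ a ∈ p.support, F a = G a) : pmfExpect p F = pmfExpect p G := by
  refine tsum_congr fun a => ?_
  by_cases ha : a ∈ p.support
  · rw [h a ha]
  · simp [toReal_pmf_eq_zero_of_notMem ha]

theorem pmfExpect_mono (hF : BoundedOnSupport F p) (hG : BoundedOnSupport G p)
    (h : ∀ a ∈ p.support, F a ≤ G a) : pmfExpect p F ≤ pmfExpect p G := by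
  refine hF.summable.tsum_le_tsum (fun a => ?_) hG.summable
  by_cases ha : a ∈ p.support
  · exact mul_le_mul_of_nonneg_left (h a ha) ENNReal.toReal_nonneg
  · simp [toReal_pmf_eq_zero_of_notMem ha]

theorem pmfExpect_nonneg (h : ∀ a, 0 ≤ F a) : 0 ≤ pmfExpect p F :=
  tsum_nonneg fun a => mul_nonneg ENNReal.toReal_nonneg (h a)

theorem apply_mul_le_pmfExpect (hF : BoundedOnSupport F p) (h : ∀ a, 0 ≤ F a) (a : α) :
    (p a).toReal * F a ≤ pmfExpect p F :=
  hF.summable.le_tsum a fun b _ => mul_nonneg ENNReal.toReal_nonneg (h b)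

theorem abs_pmfExpect_le {M : ℝ} (h : ∀ a ∈ p.support, |F a| ≤ M) : |pmfExpect p F| ≤ M := by
  have hF : BoundedOnSupport F p := ⟨M, h⟩
  refine abs_le.2 ⟨?_, ?_⟩
  · rw [← pmfExpect_const p (-M)]
    exact pmfExpect_mono (.const _) hF fun a ha => (abs_le.1 (h a ha)).1
  · rw [← pmfExpect_const p M]
    exact pmfExpect_mono hF (.const _) fun a ha => (abs_le.1 (h a ha)).2

theorem pmfExpect_pure (a : α) (F : α → ℝ) : pmfExpect (PMF.pure a) F = F a := by
  rw [pmfExpect_congr (G := fun _ => F a) (by simp), pmfExpect_const]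

theorem pmfExpect_fintype [Fintype α] (p : PMF α) (F : α → ℝ) :
    pmfExpect p F = ∑ a, (p a).toReal * F a := tsum_fintype _

end

section Bind

variable {p : PMF α} {f : α → PMF β} {F : β → ℝ}

theorem BoundedOnSupport.of_bind (hF : BoundedOnSupport F (p.bind f)) {a : α}
    (ha : a ∈ p.support) : BoundedOnSupport F (f a) :=
  hF.imp fun _ hM b hb => hM b ((PMF.mem_support_bind_iff _ _ _).2 ⟨a, ha, hb⟩)

theorem summable_toReal_mul_toReal (p : PMF α) (f : α → PMF β) :
    Summable fun x : α × β => (p x.1).toReal * (f x.1 x.2).toReal := by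
  have h0 : ∀ x : α × β, 0 ≤ (p x.1).toReal * (f x.1 x.2).toReal := fun _ => by positivity
  refine (summable_prod_of_nonneg h0).2
    ⟨fun a => (summable_toReal_pmf (f a)).mul_left (p a).toReal,
      (summable_toReal_pmf p).congr fun a => ?_⟩
  change (p a).toReal = ∑' b, (p a).toReal * (f a b).toReal
  rw [tsum_mul_left, tsum_toReal_pmf, mul_one]

theorem BoundedOnSupport.summable_bind (hF : BoundedOnSupport F (p.bind f)) :
    Summable fun x : α × β => (p x.1).toReal * (f x.1 x.2).toReal * F x.2 := by
  obtain ⟨M, hM⟩ := hF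
  refine Summable.of_norm_bounded ((summable_toReal_mul_toReal p f).mul_right M) fun x => ?_
  rw [norm_mul, Real.norm_of_nonneg (by positivity), Real.norm_eq_abs]
  by_cases ha : x.1 ∈ p.support
  · by_cases hb : x.2 ∈ (f x.1).support
    · exact mul_le_mul_of_nonneg_left
        (hM _ ((PMF.mem_support_bind_iff _ _ _).2 ⟨_, ha, hb⟩)) (by positivity)
    · simp [toReal_pmf_eq_zero_of_notMem hb]
  · simp [toReal_pmf_eq_zero_of_notMem ha]

theorem toReal_bind_apply (p : PMF α) (f : α → PMF β) (b : β) :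
    (p.bind f b).toReal = ∑' a, (p a).toReal * (f a b).toReal := by
  rw [PMF.bind_apply, ENNReal.tsum_toReal_eq fun a =>
    ENNReal.mul_ne_top (p.apply_ne_top a) ((f a).apply_ne_top b)]
  simp only [ENNReal.toReal_mul]

theorem pmfExpect_bind (hF : BoundedOnSupport F (p.bind f)) :
    pmfExpect (p.bind f) F = pmfExpect p fun a => pmfExpect (f a) F :=
  calc pmfExpect (p.bind f) F
      = ∑' b, ∑' a, (p a).toReal * (f a b).toReal * F b := by
        simp only [pmfExpect, toReal_bind_apply, tsum_mul_right]
    _ = ∑' a, ∑' b, (p a).toReal * (f a b).toReal * F b :=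
        Summable.tsum_comm (f := fun a b => (p a).toReal * (f a b).toReal * F b) hF.summable_bind
    _ = pmfExpect p fun a => pmfExpect (f a) F := by
        simp only [pmfExpect, mul_assoc, tsum_mul_left]

end Bind

theorem pmfExpect_map {p : PMF α} {f : α → β} {F : β → ℝ} (hF : BoundedOnSupport F (p.map f)) :
    pmfExpect (p.map f) F = pmfExpect p fun a => F (f a) := by
  rw [PMF.map] at hF ⊢
  simp only [pmfExpect_bind hF, Function.comp_apply, pmfExpect_pure]

/-- The mixture `s p + (1 - s) q` of two discrete distributions. -/
def pmfMix (s : ℝ) (h0 : 0 ≤ s) (h1 : s ≤ 1) (p q : PMF α) : PMF α :=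
  ⟨fun a => ENNReal.ofReal s * p a + ENNReal.ofReal (1 - s) * q a, by
    have h : ∑' a, (ENNReal.ofReal s * p a + ENNReal.ofReal (1 - s) * q a) = 1 := by
      rw [ENNReal.tsum_add, ENNReal.tsum_mul_left, ENNReal.tsum_mul_left, p.tsum_coe, q.tsum_coe,
        mul_one, mul_one, ← ENNReal.ofReal_add h0 (sub_nonneg.2 h1), add_sub_cancel,
        ENNReal.ofReal_one]
    exact h ▸ ENNReal.summable.hasSum⟩

section Mix

variable {s : ℝ} {h0 : 0 ≤ s} {h1 : s ≤ 1} {p q : PMF α} {F : α → ℝ}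

theorem toReal_pmfMix_apply (a : α) :
    (pmfMix s h0 h1 p q a).toReal = s * (p a).toReal + (1 - s) * (q a).toReal := by
  change (ENNReal.ofReal s * p a + ENNReal.ofReal (1 - s) * q a).toReal = _
  rw [ENNReal.toReal_add (ENNReal.mul_ne_top ENNReal.ofReal_ne_top (p.apply_ne_top a))
    (ENNReal.mul_ne_top ENNReal.ofReal_ne_top (q.apply_ne_top a)), ENNReal.toReal_mul,
    ENNReal.toReal_mul, ENNReal.toReal_ofReal h0, ENNReal.toReal_ofReal (sub_nonneg.2 h1)]

theorem pmfExpect_pmfMix (hp : BoundedOnSupport F p) (hq : BoundedOnSupport F q) :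
    pmfExpect (pmfMix s h0 h1 p q) F = s * pmfExpect p F + (1 - s) * pmfExpect q F := by
  simp only [pmfExpect, toReal_pmfMix_apply, add_mul, mul_assoc]
  rw [(hp.summable.mul_left s).tsum_add (hq.summable.mul_left (1 - s)), tsum_mul_left,
    tsum_mul_left]

end Mix

end Expectation

section LogMeanExp

variable {α : Type*} {p : PMF α} {F G : α → ℝ}

/-- The cumulant `log E[exp F]` of a function under a discrete distribution. -/
def logMeanExp (p : PMF α) (F : α → ℝ) : ℝ := Real.log (pmfExpect p fun a => Real.exp (F a))

theorem pmfExpect_exp_pos (hF : BoundedOnSupport F p) :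
    0 < pmfExpect p fun a => Real.exp (F a) := by
  obtain ⟨a, ha⟩ := p.support_nonempty
  refine lt_of_lt_of_le ?_ (apply_mul_le_pmfExpect hF.exp (fun a => (Real.exp_pos _).le) a)
  exact mul_pos (ENNReal.toReal_pos ha (p.apply_ne_top a)) (Real.exp_pos _)

theorem exp_logMeanExp (hF : BoundedOnSupport F p) :
    Real.exp (logMeanExp p F) = pmfExpect p fun a => Real.exp (F a) :=
  Real.exp_log (pmfExpect_exp_pos hF)

theorem logMeanExp_le_iff (hF : BoundedOnSupport F p) {c : ℝ} :
    logMeanExp p F ≤ c ↔ pmfExpect p (fun a => Real.exp (F a)) ≤ Real.exp c :=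
  Real.log_le_iff_le_exp (pmfExpect_exp_pos hF)

theorem le_logMeanExp_iff (hF : BoundedOnSupport F p) {c : ℝ} :
    c ≤ logMeanExp p F ↔ Real.exp c ≤ pmfExpect p fun a => Real.exp (F a) :=
  Real.le_log_iff_exp_le (pmfExpect_exp_pos hF)

theorem abs_logMeanExp_le {M : ℝ} (h : ∀ a ∈ p.support, |F a| ≤ M) : |logMeanExp p F| ≤ M := by
  have hF : BoundedOnSupport F p := ⟨M, h⟩
  rw [abs_le, le_logMeanExp_iff hF, logMeanExp_le_iff hF]
  constructor
  · rw [← pmfExpect_const p (Real.exp (-M))]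
    exact pmfExpect_mono (.const _) hF.exp fun a ha => Real.exp_le_exp.2 (abs_le.1 (h a ha)).1
  · rw [← pmfExpect_const p (Real.exp M)]
    exact pmfExpect_mono hF.exp (.const _) fun a ha => Real.exp_le_exp.2 (abs_le.1 (h a ha)).2

theorem add_log_apply_le_logMeanExp (hF : BoundedOnSupport F p) {a : α} (ha : a ∈ p.support) :
    F a + Real.log (p a).toReal ≤ logMeanExp p F := by
  have hp : 0 < (p a).toReal := ENNReal.toReal_pos ha (p.apply_ne_top a)
  rw [le_logMeanExp_iff hF, Real.exp_add, Real.exp_log hp, mul_comm]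
  exact apply_mul_le_pmfExpect hF.exp (fun a => (Real.exp_pos _).le) a

theorem logMeanExp_le_add_sq (h : ∀ a ∈ p.support, |F a| ≤ 1) :
    logMeanExp p F ≤ pmfExpect p F + pmfExpect p fun a => F a ^ 2 := by
  have hF : BoundedOnSupport F p := ⟨1, h⟩
  have hexp : pmfExpect p (fun a => Real.exp (F a)) ≤ pmfExpect p fun a => 1 + (F a + F a ^ 2) := by
    refine pmfExpect_mono (by fun_prop) (by fun_prop) fun a ha => ?_
    linarith [(abs_le.1 (Real.abs_exp_sub_one_sub_id_le (h a ha))).2]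
  simp (disch := fun_prop) only [pmfExpect_add, pmfExpect_const] at hexp
  rw [logMeanExp]
  linarith [Real.log_le_sub_one_of_pos (pmfExpect_exp_pos hF)]

/- With `ℓ = log E[exp F]`, convexity of `exp` gives `exp (θ (F - ℓ)) ≤ 1 - θ + θ exp (F - ℓ)`,
and the right side has mean `1`. -/
theorem logMeanExp_const_mul_le (hF : BoundedOnSupport F p) {θ : ℝ} (h0 : 0 ≤ θ) (h1 : θ ≤ 1) :
    logMeanExp p (fun a => θ * F a) ≤ θ * logMeanExp p F := by
  set ℓ := logMeanExp p F
  rw [logMeanExp_le_iff (by fun_prop)]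
  have hconv : ∀ a, Real.exp (θ * F a) ≤
      Real.exp (θ * ℓ) * (1 - θ + θ * Real.exp (-ℓ) * Real.exp (F a)) := fun a => by
    have hjensen := convexOn_exp.2 (Set.mem_univ 0) (Set.mem_univ (F a - ℓ)) (sub_nonneg.2 h1) h0
      (sub_add_cancel 1 θ)
    simp only [smul_eq_mul, mul_zero, zero_add, Real.exp_zero, mul_one] at hjensen
    calc Real.exp (θ * F a) = Real.exp (θ * ℓ) * Real.exp (θ * (F a - ℓ)) := by
          rw [← Real.exp_add]; ring_nf
      _ ≤ Real.exp (θ * ℓ) * (1 - θ + θ * Real.exp (F a - ℓ)) := by gcongr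
      _ = _ := by rw [sub_eq_neg_add (F a), Real.exp_add]; ring
  refine (pmfExpect_mono (by fun_prop) (by fun_prop) fun a _ => hconv a).trans_eq ?_
  simp (disch := fun_prop) only [pmfExpect_const_mul, pmfExpect_add, pmfExpect_const]
  rw [← exp_logMeanExp hF, mul_assoc, ← Real.exp_add, neg_add_cancel, Real.exp_zero]
  ring

theorem logMeanExp_div_mono (hF : BoundedOnSupport F p) {s t : ℝ} (hs : 0 < s) (hst : s ≤ t) :
    logMeanExp p (fun a => s * F a) / s ≤ logMeanExp p (fun a => t * F a) / t := by
  have ht : 0 < t := hs.trans_le hst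
  have h := logMeanExp_const_mul_le (F := fun a => t * F a) (p := p) (by fun_prop)
    (div_nonneg hs.le ht.le) ((div_le_one ht).2 hst)
  simp only [← mul_assoc, div_mul_cancel₀ s ht.ne'] at h
  calc logMeanExp p (fun a => s * F a) / s
      ≤ s / t * logMeanExp p (fun a => t * F a) / s := by gcongr
    _ = logMeanExp p (fun a => t * F a) / t := by field_simp

/-- The distribution with density proportional to `exp F` with respect to `p`. -/
def pmfTilt (p : PMF α) (F : α → ℝ) (hF : BoundedOnSupport F p) : PMF α :=
  PMF.normalize (fun a => p a * ENNReal.ofReal (Real.exp (F a)))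
    (by
      obtain ⟨a, ha⟩ := p.support_nonempty
      exact (ENNReal.summable.tsum_ne_zero_iff).2 ⟨a, mul_ne_zero ha
        (ENNReal.ofReal_pos.2 (Real.exp_pos _)).ne'⟩)
    (by
      have hofReal : ∀ a, p a * ENNReal.ofReal (Real.exp (F a)) =
          ENNReal.ofReal ((p a).toReal * Real.exp (F a)) := fun a => by
        rw [ENNReal.ofReal_mul ENNReal.toReal_nonneg, ENNReal.ofReal_toReal (p.apply_ne_top a)]
      simpa only [hofReal] using hF.exp.summable.tsum_ofReal_ne_top)

theorem toReal_pmfTilt_apply (hF : BoundedOnSupport F p) (a : α) :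
    (pmfTilt p F hF a).toReal = (p a).toReal * Real.exp (F a) /
      pmfExpect p fun a => Real.exp (F a) := by
  have hZ : (∑' a, p a * ENNReal.ofReal (Real.exp (F a))).toReal =
      pmfExpect p fun a => Real.exp (F a) := by
    rw [ENNReal.tsum_toReal_eq fun a => ENNReal.mul_ne_top (p.apply_ne_top a) ENNReal.ofReal_ne_top]
    simp only [pmfExpect, ENNReal.toReal_mul, ENNReal.toReal_ofReal (Real.exp_pos _).le]
  rw [pmfTilt, PMF.normalize_apply, ENNReal.toReal_mul, ENNReal.toReal_inv, hZ,
    ENNReal.toReal_mul, ENNReal.toReal_ofReal (Real.exp_pos _).le, div_eq_mul_inv]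

theorem pmfExpect_pmfTilt (hF : BoundedOnSupport F p) (G : α → ℝ) :
    pmfExpect (pmfTilt p F hF) G =
      pmfExpect p (fun a => Real.exp (F a) * G a) / pmfExpect p fun a => Real.exp (F a) := by
  rw [div_eq_inv_mul, ← pmfExpect_const_mul]
  refine tsum_congr fun a => ?_
  rw [toReal_pmfTilt_apply]
  ring

theorem logMeanExp_add (hF : BoundedOnSupport F p) (hG : BoundedOnSupport G p) :
    logMeanExp p (fun a => F a + G a) = logMeanExp p F + logMeanExp (pmfTilt p F hF) G := by
  have hFG := pmfExpect_exp_pos (F := fun a => F a + G a) (p := p) (by fun_prop)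
  simp only [Real.exp_add] at hFG
  simp only [logMeanExp, pmfExpect_pmfTilt, Real.exp_add]
  rw [Real.log_div hFG.ne' (pmfExpect_exp_pos hF).ne', add_sub_cancel]

end LogMeanExp

/-! ### Coercive matrices and second moments -/

section CoerciveMatrix

open Matrix

variable {ι : Type*} [Fintype ι]

theorem dotProduct_self_le_card {v : ι → ℝ} (hv : ∀ i, |v i| ≤ 1) :
    v ⬝ᵥ v ≤ Fintype.card ι := by
  have hsq : ∀ i ∈ Finset.univ, v i * v i ≤ 1 := fun i _ => by
    simpa only [sq] using sq_le_one_iff_abs_le_one (v i) |>.2 (hv i)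
  simpa [dotProduct] using Finset.sum_le_sum hsq

theorem two_mul_abs_dotProduct_le (v w : ι → ℝ) : 2 * |v ⬝ᵥ w| ≤ v ⬝ᵥ v + w ⬝ᵥ w := by
  have hadd : 0 ≤ (v + w) ⬝ᵥ (v + w) := dotProduct_self_star_nonneg (v + w)
  have hsub : 0 ≤ (v - w) ⬝ᵥ (v - w) := dotProduct_self_star_nonneg (v - w)
  simp only [add_dotProduct, dotProduct_add, sub_dotProduct, dotProduct_sub,
    dotProduct_comm w v] at hadd hsub
  rcases abs_cases (v ⬝ᵥ w) with h | h <;> linarith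

variable [DecidableEq ι] {Q : Matrix ι ι ℝ} {κ : ℝ}

theorem isUnit_det_of_coercive (hκ : 0 < κ) (hQ : ∀ w, κ * (w ⬝ᵥ w) ≤ w ⬝ᵥ Q *ᵥ w) :
    IsUnit Q.det := by
  refine isUnit_iff_ne_zero.2 fun hdet => ?_
  obtain ⟨w, hw, hQw⟩ := Matrix.exists_mulVec_eq_zero_iff.2 hdet
  have hpos : 0 < w ⬝ᵥ w := dotProduct_self_star_pos_iff.2 hw
  have hle := hQ w
  rw [hQw, dotProduct_zero] at hle
  exact absurd hle (mul_pos hκ hpos).not_ge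

/- With `w = Q⁻¹ u`, coercivity gives `κ |w|² ≤ w ⬝ u ≤ |w| |u|`, hence `κ |w| ≤ |u|`. -/
theorem abs_dotProduct_inv_mulVec_le (hκ : 0 < κ) (hQ : ∀ w, κ * (w ⬝ᵥ w) ≤ w ⬝ᵥ Q *ᵥ w)
    {u v : ι → ℝ} (hu : ∀ i, |u i| ≤ 1) (hv : ∀ i, |v i| ≤ 1) :
    |v ⬝ᵥ Q⁻¹ *ᵥ u| ≤ Fintype.card ι / κ := by
  set w := Q⁻¹ *ᵥ u
  have hQw : Q *ᵥ w = u := by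
    rw [mulVec_mulVec, mul_nonsing_inv _ (isUnit_det_of_coercive hκ hQ), one_mulVec]
  have hcoercive : κ * (w ⬝ᵥ w) ≤ w ⬝ᵥ u := by simpa only [hQw] using hQ w
  have hscaled : ∀ x : ι → ℝ, 2 * (κ * |x ⬝ᵥ w|) ≤ x ⬝ᵥ x + κ * (κ * (w ⬝ᵥ w)) := fun x => by
    have := two_mul_abs_dotProduct_le x (κ • w)
    rwa [dotProduct_smul, smul_dotProduct, dotProduct_smul, smul_eq_mul, smul_eq_mul, smul_eq_mul,
      abs_mul, abs_of_pos hκ] at this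
  have hnorm : κ * (κ * (w ⬝ᵥ w)) ≤ u ⬝ᵥ u := by
    have := hscaled u
    have hle : κ * (κ * (w ⬝ᵥ w)) ≤ κ * |u ⬝ᵥ w| := by
      rw [dotProduct_comm u]
      gcongr
      exact hcoercive.trans (le_abs_self _)
    linarith
  rw [le_div_iff₀ hκ]
  linarith [hscaled v, dotProduct_self_le_card hu, dotProduct_self_le_card hv]

end CoerciveMatrix

section SecondMoment

open Matrix

variable {α ι : Type*} {P : PMF α} {a : α → ι → ℝ}

/-- The second moment matrix `E[a aᵀ]` of a random vector `a`. -/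
def secondMoment (P : PMF α) (a : α → ι → ℝ) : Matrix ι ι ℝ :=
  Matrix.of fun i j => pmfExpect P fun x => a x i * a x j

theorem secondMoment_apply (i j : ι) :
    secondMoment P a i j = pmfExpect P fun x => a x i * a x j := rfl

theorem secondMoment_transpose : (secondMoment P a)ᵀ = secondMoment P a := by
  ext i j
  simp only [transpose_apply, secondMoment_apply, mul_comm]

variable [Fintype ι]

theorem dotProduct_secondMoment_mulVec (ha : ∀ i, BoundedOnSupport (fun x => a x i) P)
    (v w : ι → ℝ) :
    v ⬝ᵥ secondMoment P a *ᵥ w = pmfExpect P fun x => (v ⬝ᵥ a x) * (w ⬝ᵥ a x) := by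
  have hexpand : ∀ x, (v ⬝ᵥ a x) * (w ⬝ᵥ a x) = ∑ i, ∑ j, v i * w j * (a x i * a x j) := fun x => by
    simp only [dotProduct, Finset.sum_mul_sum, mul_mul_mul_comm]
  simp (disch := fun_prop) only [hexpand, pmfExpect_sum, pmfExpect_const_mul]
  simp only [dotProduct, mulVec, Finset.mul_sum, secondMoment_apply, mul_assoc, mul_comm (w _)]

variable [DecidableEq ι]

theorem dotProduct_inv_secondMoment_mulVec_comm (u v : ι → ℝ) :
    u ⬝ᵥ (secondMoment P a)⁻¹ *ᵥ v = ((secondMoment P a)⁻¹ *ᵥ u) ⬝ᵥ v := by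
  rw [dotProduct_mulVec, ← mulVec_transpose, transpose_nonsing_inv, secondMoment_transpose]

variable (ha : ∀ i, BoundedOnSupport (fun x => a x i) P) (hdet : IsUnit (secondMoment P a).det)
include ha hdet

theorem pmfExpect_leastSquares (v g : ι → ℝ) :
    pmfExpect P (fun z => (v ⬝ᵥ (secondMoment P a)⁻¹ *ᵥ a z) * (g ⬝ᵥ a z)) = v ⬝ᵥ g := by
  simp only [dotProduct_inv_secondMoment_mulVec_comm]
  rw [← dotProduct_secondMoment_mulVec ha, ← dotProduct_inv_secondMoment_mulVec_comm,
    mulVec_mulVec, nonsing_inv_mul _ hdet, one_mulVec]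

theorem pmfExpect_leastSquares_sq (v : ι → ℝ) :
    pmfExpect P (fun z => (v ⬝ᵥ (secondMoment P a)⁻¹ *ᵥ a z) ^ 2) =
      v ⬝ᵥ (secondMoment P a)⁻¹ *ᵥ v := by
  rw [← pmfExpect_leastSquares ha hdet v ((secondMoment P a)⁻¹ *ᵥ v)]
  simp only [sq, dotProduct_inv_secondMoment_mulVec_comm]

theorem pmfExpect_dotProduct_inv_secondMoment :
    pmfExpect P (fun z => a z ⬝ᵥ (secondMoment P a)⁻¹ *ᵥ a z) = Fintype.card ι := by
  have hexpand : ∀ (R : Matrix ι ι ℝ) x, a x ⬝ᵥ R *ᵥ a x = ∑ i, ∑ j, R i j * (a x j * a x i) :=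
    fun R x => by
      simp only [dotProduct, mulVec, Finset.mul_sum]
      exact Finset.sum_congr rfl fun i _ => Finset.sum_congr rfl fun j _ => by ring
  have htrace : ((secondMoment P a)⁻¹ * secondMoment P a).trace = Fintype.card ι := by
    rw [nonsing_inv_mul _ hdet, trace_one]
  generalize (secondMoment P a)⁻¹ = R at htrace ⊢
  simp (disch := fun_prop) only [hexpand, pmfExpect_sum, pmfExpect_const_mul]
  rw [← htrace]
  simp only [trace, diag_apply, mul_apply, secondMoment_apply]

end SecondMoment

/-! ### Net priors and barycentric spanners -/

section NetPrior

variable {α β : Type*}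

/-- The geometric distribution with `P(n) = 2⁻⁽ⁿ⁺¹⁾`, which weights the scales of a net prior. -/
def dyadicPMF : PMF ℕ :=
  ⟨fun n => 2⁻¹ ^ (n + 1), ENNReal.summable.hasSum_iff.2 <| by
    rw [ENNReal.tsum_geometric_add_one, ENNReal.one_sub_inv_two, inv_inv,
      ENNReal.inv_mul_cancel two_ne_zero ENNReal.ofNat_ne_top]⟩

theorem mul_apply_le_bind_apply (p : PMF α) (f : α → PMF β) (a : α) (b : β) :
    p a * f a b ≤ p.bind f b :=
  ENNReal.le_tsum a

theorem apply_le_map_apply (p : PMF α) (f : α → β) (a : α) : p a ≤ p.map f (f a) := by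
  simpa using mul_apply_le_bind_apply p (PMF.pure ∘ f) a (f a)

theorem exists_pmf_inv_card_le_fiber [Nonempty α] [Fintype β] (cell : α → β) :
    ∃ π : PMF α, ∀ x, ∃ x', cell x' = cell x ∧ (Fintype.card β : ENNReal)⁻¹ ≤ π x' := by
  have : Nonempty β := .map cell ‹_›
  refine ⟨(PMF.uniformOfFintype β).map (Function.invFun cell), fun x =>
    ⟨Function.invFun cell (cell x), Function.invFun_eq ⟨x, rfl⟩, ?_⟩⟩
  rw [← PMF.uniformOfFintype_apply (cell x)]
  exact apply_le_map_apply _ _ _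

/-- The index of the interval of length `2⁻ᵏ` that contains the point `s` of `[-1, 1]`. -/
def gridIndex (k : ℕ) (s : ℝ) : Fin (2 ^ (k + 1) + 1) := Fin.ofNat _ ⌊(s + 1) * 2 ^ k⌋₊

theorem val_gridIndex {k : ℕ} {s : ℝ} (hs : s ≤ 1) :
    (gridIndex k s : ℕ) = ⌊(s + 1) * 2 ^ k⌋₊ := by
  refine Nat.mod_eq_of_lt (Nat.lt_succ_of_le (Nat.floor_le_of_le ?_))
  push_cast
  rw [pow_succ']
  gcongr
  linarith

theorem abs_sub_le_of_gridIndex_eq {k : ℕ} {s s' : ℝ} (hs : |s| ≤ 1) (hs' : |s'| ≤ 1)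
    (h : gridIndex k s = gridIndex k s') : |s - s'| ≤ 1 / 2 ^ k := by
  have hfloor : ∀ {r : ℝ}, |r| ≤ 1 →
      (gridIndex k r : ℝ) ≤ (r + 1) * 2 ^ k ∧ (r + 1) * 2 ^ k < gridIndex k r + 1 := fun hr => by
    rw [val_gridIndex (abs_le.1 hr).2]
    exact ⟨Nat.floor_le (mul_nonneg (by linarith [(abs_le.1 hr).1]) (by positivity)),
      Nat.lt_floor_add_one _⟩
  have hk : (0 : ℝ) < 2 ^ k := by positivity
  rw [le_div_iff₀ hk, ← abs_of_pos hk, ← abs_mul, abs_le]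
  have := hfloor hs
  have := h ▸ hfloor hs'
  constructor <;> linarith

/-- The distribution `π` gives, for every scale `2⁻ᵏ`, large mass to the points of a net of that
scale for the coordinates `a`. The exponent is `log₂` of the size `2^(|ι| (k + 2))` of the net plus
the cost `k + 1` of a dyadic weight for the scale. -/
def IsNetPrior {ι : Type*} [Fintype ι] (a : α → ι → ℝ) (π : PMF α) : Prop :=
  ∀ (k : ℕ) (x : α), ∃ x', (∀ i, |a x i - a x' i| ≤ 1 / 2 ^ k) ∧
    2⁻¹ ^ ((k + 1) + Fintype.card ι * (k + 2)) ≤ π x'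

theorem exists_isNetPrior {ι : Type*} [Fintype ι] [Nonempty α] {a : α → ι → ℝ}
    (ha : ∀ x i, |a x i| ≤ 1) : ∃ π, IsNetPrior a π := by
  classical
  choose net hnet using fun k => exists_pmf_inv_card_le_fiber fun x i => gridIndex k (a x i)
  refine ⟨dyadicPMF.bind net, fun k x => ?_⟩
  obtain ⟨x', hcell, hmass⟩ := hnet k x
  refine ⟨x', fun i => abs_sub_le_of_gridIndex_eq (ha x i) (ha x' i) (congrFun hcell i).symm, ?_⟩
  refine le_trans ?_ (mul_apply_le_bind_apply _ _ k x')
  have hcard : Fintype.card (ι → Fin (2 ^ (k + 1) + 1)) ≤ 2 ^ (Fintype.card ι * (k + 2)) := by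
    rw [Fintype.card_fun, Fintype.card_fin, mul_comm, pow_mul]
    gcongr
    rw [pow_succ _ (k + 1)]
    linarith [Nat.one_le_two_pow (n := k + 1)]
  rw [pow_add]
  refine mul_le_mul_right (le_trans ?_ hmass) _
  rw [ENNReal.inv_pow.symm]
  exact ENNReal.inv_le_inv.2 (mod_cast hcard)

theorem neg_log_toReal_le {p : ENNReal} (hp : p ≠ ⊤) {n : ℕ} (h : 2⁻¹ ^ n ≤ p) :
    -Real.log p.toReal ≤ n * Real.log 2 := by
  have hreal : ((2 : ℝ) ^ n)⁻¹ ≤ p.toReal := by simpa using ENNReal.toReal_mono hp h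
  have := Real.log_le_log (by positivity) hreal
  rw [Real.log_inv, Real.log_pow] at this
  linarith

end NetPrior

section BarycentricSpanner

open Module

variable {V : Type*} [NormedAddCommGroup V] [NormedSpace ℝ V] [FiniteDimensional ℝ V]

theorem exists_isUnit_det_of_span_eq_top {X : Set V} (hspan : Submodule.span ℝ X = ⊤)
    (e : Basis (Fin (finrank ℝ V)) ℝ V) :
    ∃ f : Fin (finrank ℝ V) → V, (∀ i, f i ∈ X) ∧ IsUnit (e.det f) := by
  have h := Submodule.exists_fun_fin_finrank_span_eq ℝ X
  rw [hspan, finrank_top] at h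
  obtain ⟨f, hfX, hfspan, hfli⟩ := h
  exact ⟨f, hfX, e.is_basis_iff_det.1 ⟨hfli, hfspan⟩⟩

/- The members of `X` with maximal `|det|` form such a basis: by Cramer's rule a coordinate larger
than `1` would allow an exchange that increases `|det|`. -/
theorem exists_basis_abs_repr_le_one {X : Set V} (hX : IsCompact X)
    (hspan : Submodule.span ℝ X = ⊤) :
    ∃ b : Basis (Fin (finrank ℝ V)) ℝ V, (∀ i, b i ∈ X) ∧ ∀ x ∈ X, ∀ i, |b.repr x i| ≤ 1 := by
  let e := finBasis ℝ V
  obtain ⟨f, hfX, hf⟩ := exists_isUnit_det_of_span_eq_top hspan e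
  have hcont : Continuous fun v => |e.det v| := by
    simp only [Basis.det_apply]
    exact (Continuous.matrix_det (continuous_matrix fun i j =>
      (e.coord i).continuous_of_finiteDimensional.comp (continuous_apply j))).abs
  obtain ⟨v, hvX, hvmax⟩ := (isCompact_univ_pi fun _ => hX).exists_isMaxOn
    ⟨f, fun i _ => hfX i⟩ hcont.continuousOn
  have hvpos : 0 < |e.det v| := (abs_pos.2 hf.ne_zero).trans_le (hvmax fun i _ => hfX i)
  obtain ⟨hli, hsp⟩ := e.is_basis_iff_det.2 (isUnit_iff_ne_zero.2 (abs_pos.1 hvpos))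
  refine ⟨.mk hli hsp.ge, fun i => ?_, fun x hx i => ?_⟩
  · rw [Basis.mk_apply]
    exact hvX i trivial
  · have hcramer : e.det v * (Basis.mk hli hsp.ge).repr x i = e.det (Function.update v i x) :=
      LinearMap.congr_fun (e.det_smul_mk_coord_eq_det_update hli hsp.ge i) x
    have hexchange : |e.det (Function.update v i x)| ≤ |e.det v| :=
      hvmax ((Set.update_mem_pi_iff_of_mem hvX).2 fun _ => hx)
    rw [← hcramer, abs_mul] at hexchange
    exact le_of_mul_le_mul_left (hexchange.trans_eq (mul_one _).symm) hvpos

theorem exists_barycentric_spanner {X : Set V} (hX : IsCompact X) :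
    ∃ (d : ℕ) (b : Fin d → X) (coord : X → Fin d → ℝ), d ≤ finrank ℝ V ∧
      (∀ x i, |coord x i| ≤ 1) ∧ (∀ x : X, (x : V) = ∑ i, coord x i • (b i : V)) ∧
      ∀ i, coord (b i) = Pi.single i 1 := by
  set W := Submodule.span ℝ X
  have hcompact : IsCompact (Subtype.val ⁻¹' X : Set W) :=
    W.closed_of_finiteDimensional.isClosedEmbedding_subtypeVal.isCompact_preimage hX
  obtain ⟨b, hbX, hb⟩ := exists_basis_abs_repr_le_one hcompact
    (Submodule.span_span_coe_preimage (R := ℝ) (s := X))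
  refine ⟨_, fun i => ⟨b i, hbX i⟩, fun x => b.repr ⟨x, Submodule.subset_span x.2⟩,
    W.finrank_le, fun x => hb _ x.2, fun x => ?_, fun i => ?_⟩
  · simpa only [Submodule.coe_sum, Submodule.coe_smul] using
      congrArg Subtype.val (b.sum_repr ⟨x, Submodule.subset_span x.2⟩).symm
  · simp [Finsupp.single_eq_pi_single]

end BarycentricSpanner

/-! ### Learning rates -/

section Rates

/-- The decay `√(log (t + 3) / (t + 3))` of anytime learning rates. The shift by `3 > e` makes it
decreasing from the start. -/
def rateDecay (t : ℕ) : ℝ := √(Real.log (t + 3) / (t + 3))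

theorem rateDecay_pos (t : ℕ) : 0 < rateDecay t :=
  Real.sqrt_pos.2 (div_pos (Real.log_pos (by linarith [t.cast_nonneg (α := ℝ)])) (by positivity))

theorem rateDecay_antitone : Antitone rateDecay := fun s t hst => by
  have hexp : ∀ r : ℕ, Real.exp 1 ≤ (r : ℝ) + 3 := fun r => by
    linarith [Real.exp_one_lt_three, r.cast_nonneg (α := ℝ)]
  exact Real.sqrt_le_sqrt (Real.log_div_self_antitoneOn (hexp s) (hexp t) (by gcongr))

theorem sum_inv_sqrt_succ_le (T : ℕ) : ∑ t ∈ Finset.range T, (√((t : ℝ) + 1))⁻¹ ≤ 2 * √T := by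
  induction T with
  | zero => simp
  | succ n ih =>
    have hpos : 0 < √((n : ℝ) + 1) := by positivity
    have hstep : (√((n : ℝ) + 1))⁻¹ ≤ 2 * (√((n : ℝ) + 1) - √n) := by
      rw [inv_le_iff_one_le_mul₀ hpos]
      nlinarith [Real.sq_sqrt (show (0 : ℝ) ≤ n + 1 by positivity),
        Real.sq_sqrt (show (0 : ℝ) ≤ n by positivity), sq_nonneg (√((n : ℝ) + 1) - √n)]
    rw [Finset.sum_range_succ]
    push_cast
    linarith

section Horizon

variable {T : ℕ} (hT : 2 ≤ T)
include hT

theorem log_pos_of_two_le : 0 < Real.log T := Real.log_pos (by exact_mod_cast hT)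

theorem log_add_three_le : Real.log (T + 3) ≤ 3 * Real.log T := by
  have h : (2 : ℝ) ≤ T := by exact_mod_cast hT
  have hcube : (T : ℝ) + 3 ≤ T ^ 3 := by nlinarith [mul_nonneg (sub_nonneg.2 h) (sub_nonneg.2 h)]
  simpa using Real.log_le_log (by positivity) hcube

theorem one_le_sqrt_mul_log : 1 ≤ √(T * Real.log T) := by
  have h : (2 : ℝ) ≤ T := by exact_mod_cast hT
  rw [Real.one_le_sqrt]
  nlinarith [Real.log_le_log (by norm_num) h, Real.log_two_gt_d9]

theorem sum_rateDecay_le : ∑ t ∈ Finset.range T, rateDecay t ≤ 4 * √(T * Real.log T) := by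
  have hL := log_pos_of_two_le hT
  have hterm : ∀ t ∈ Finset.range T, rateDecay t ≤ √(3 * Real.log T) * (√((t : ℝ) + 1))⁻¹ := by
    intro t ht
    have htT : (t : ℝ) ≤ T := by exact_mod_cast (Finset.mem_range.1 ht).le
    have hlog : Real.log ((t : ℝ) + 3) ≤ 3 * Real.log T :=
      (Real.log_le_log (by positivity) (by linarith)).trans (log_add_three_le hT)
    rw [rateDecay, Real.sqrt_div' _ (by positivity), div_eq_mul_inv]
    gcongr
    norm_num
  have hthree : √(3 : ℝ) ≤ 2 := Real.sqrt_le_iff.2 ⟨by norm_num, by norm_num⟩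
  calc ∑ t ∈ Finset.range T, rateDecay t ≤ √(3 * Real.log T) * (2 * √T) :=
        (Finset.sum_le_sum hterm).trans <| by
          rw [← Finset.mul_sum]
          gcongr
          exact sum_inv_sqrt_succ_le T
    _ = 2 * √3 * √(T * Real.log T) := by
        rw [Real.sqrt_mul (by norm_num), Real.sqrt_mul T.cast_nonneg]
        ring
    _ ≤ 4 * √(T * Real.log T) := by
        gcongr
        linarith

theorem log_mul_inv_rateDecay_le :
    Real.log T * (rateDecay T)⁻¹ ≤ 2 * √(T * Real.log T) := by
  have hL := log_pos_of_two_le hT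
  have h : (2 : ℝ) ≤ T := by exact_mod_cast hT
  have hdecay : √(Real.log T) / (2 * √T) ≤ rateDecay T := by
    have htwo : 2 * √(T : ℝ) = √(4 * T) := by
      rw [Real.sqrt_mul (by norm_num), show (4 : ℝ) = 2 ^ 2 by norm_num,
        Real.sqrt_sq (by norm_num)]
    rw [htwo, ← Real.sqrt_div hL.le]
    exact Real.sqrt_le_sqrt
      (div_le_div₀ (Real.log_nonneg (by linarith)) (by gcongr; linarith) (by positivity)
        (by linarith))
  calc Real.log T * (rateDecay T)⁻¹ ≤ Real.log T * (√(Real.log T) / (2 * √T))⁻¹ := by gcongr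
    _ = 2 * √(T * Real.log T) := by
        rw [Real.sqrt_mul T.cast_nonneg]
        have := Real.mul_self_sqrt hL.le
        field_simp
        linarith

theorem exists_le_two_pow :
    ∃ k : ℕ, (T : ℝ) ≤ 2 ^ k ∧ ((k : ℝ) + 2) * Real.log 2 ≤ 4 * Real.log T := by
  refine ⟨Nat.clog 2 T, by exact_mod_cast Nat.le_pow_clog one_lt_two T, ?_⟩
  obtain ⟨j, hj⟩ := Nat.exists_eq_succ_of_ne_zero (Nat.clog_pos one_lt_two hT).ne'
  have hpred : (2 : ℝ) ^ j ≤ T := by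
    have := Nat.pow_pred_clog_lt_self one_lt_two (show 1 < T by omega)
    rw [hj] at this
    exact_mod_cast this.le
  have hpow : (2 : ℝ) ^ (j + 3) ≤ (T : ℝ) ^ (1 + 3) := by
    rw [pow_add, pow_add, pow_one]
    gcongr
    exact_mod_cast hT
  have := Real.log_le_log (by positivity) hpow
  rw [Real.log_pow, Real.log_pow] at this
  rw [hj]
  push_cast at this ⊢
  linarith

end Horizon

/-- Anytime learning rates for dimension `m` and payoffs bounded by `B`. The cap keeps the
probability of exploration below `1 / 2`. -/
def anytimeRate (m B : ℝ) (t : ℕ) : ℝ :=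
  min (1 / (2 * m ^ 2 * B)) (rateDecay t / (B * √m))

section AnytimeRate

variable {m B : ℝ}

theorem anytimeRate_antitone (hB : 0 < B) : Antitone (anytimeRate m B) := fun _ _ h =>
  min_le_min le_rfl (div_le_div_of_nonneg_right (rateDecay_antitone h) (by positivity))

section

variable (hm : 0 < m) (hB : 0 < B)
include hm hB

theorem anytimeRate_pos (t : ℕ) : 0 < anytimeRate m B t :=
  lt_min (by positivity) (div_pos (rateDecay_pos t) (by positivity))

theorem anytimeRate_mul_le (t : ℕ) : anytimeRate m B t * m ^ 2 * B ≤ 1 / 2 := by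
  have h := min_le_left (1 / (2 * m ^ 2 * B)) (rateDecay t / (B * √m))
  rw [le_div_iff₀ (by positivity)] at h
  rw [anytimeRate]
  linarith

theorem inv_anytimeRate_le (t : ℕ) :
    (anytimeRate m B t)⁻¹ ≤ 2 * m ^ 2 * B + B * √m * (rateDecay t)⁻¹ := by
  have := rateDecay_pos t
  rcases min_choice (1 / (2 * m ^ 2 * B)) (rateDecay t / (B * √m)) with h | h
  · rw [anytimeRate, h, one_div, inv_inv]
    exact le_add_of_nonneg_right (by positivity)
  · rw [anytimeRate, h, inv_div, div_eq_mul_inv]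
    exact le_add_of_nonneg_left (by positivity)

end

theorem mul_sqrt_mul_sqrt (hm : 0 ≤ m) (x : ℝ) : m * √m * √x = √(m ^ 3 * x) := by
  rw [Real.sqrt_mul (by positivity), pow_succ, Real.sqrt_mul (by positivity), Real.sqrt_sq hm]

theorem le_mul_sqrt_mul_sqrt {T L : ℝ} (hm : 0 ≤ m) (hT : 0 ≤ T) (h : T ≤ m ^ 3 * L) :
    T ≤ m * √m * √(T * L) := by
  rw [mul_sqrt_mul_sqrt hm]
  exact Real.le_sqrt_of_sq_le (by nlinarith)

theorem cube_mul_le_mul_sqrt_mul_sqrt {T L : ℝ} (hm : 0 ≤ m) (hL : 0 ≤ L) (h : m ^ 3 * L ≤ T) :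
    m ^ 3 * L ≤ m * √m * √(T * L) := by
  rw [mul_sqrt_mul_sqrt hm]
  exact Real.le_sqrt_of_sq_le (by nlinarith [mul_nonneg (pow_nonneg hm 3) hL])

variable {T : ℕ} (hT : 2 ≤ T)
include hT

theorem log_mul_inv_anytimeRate_le (hm : 0 < m) (hB : 0 < B) (hlarge : m ^ 3 * Real.log T ≤ T) :
    m * Real.log T * (anytimeRate m B T)⁻¹ ≤ 4 * (B * (m * √m) * √(T * Real.log T)) := by
  have hL := log_pos_of_two_le hT
  calc m * Real.log T * (anytimeRate m B T)⁻¹ ≤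
        m * Real.log T * (2 * m ^ 2 * B + B * √m * (rateDecay T)⁻¹) := by
        gcongr
        exact inv_anytimeRate_le hm hB T
    _ = 2 * B * (m ^ 3 * Real.log T) + B * (m * √m) * (Real.log T * (rateDecay T)⁻¹) := by ring
    _ ≤ 2 * B * (m * √m * √(T * Real.log T)) + B * (m * √m) * (2 * √(T * Real.log T)) :=
        add_le_add
          (mul_le_mul_of_nonneg_left (cube_mul_le_mul_sqrt_mul_sqrt hm.le hL.le hlarge)
            (by positivity))
          (mul_le_mul_of_nonneg_left (log_mul_inv_rateDecay_le hT) (by positivity))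
    _ = 4 * (B * (m * √m) * √(T * Real.log T)) := by ring

theorem sum_anytimeRate_le (hm : 0 < m) (hB : 0 < B) :
    m ^ 2 * B ^ 2 * ∑ t ∈ Finset.range T, anytimeRate m B t ≤
      4 * (B * (m * √m) * √(T * Real.log T)) := by
  have hsum : ∑ t ∈ Finset.range T, anytimeRate m B t ≤ 4 * √(T * Real.log T) / (B * √m) := by
    refine (Finset.sum_le_sum fun t _ => min_le_right _ _).trans ?_
    rw [← Finset.sum_div]
    gcongr
    exact sum_rateDecay_le hT
  calc _ ≤ m ^ 2 * B ^ 2 * (4 * √(T * Real.log T) / (B * √m)) := by gcongr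
    _ = 4 * (B * (m * √m) * √(T * Real.log T)) := by
        field_simp
        rw [Real.sq_sqrt hm.le, mul_comm]

end AnytimeRate

end Rates

/-! ### Histories of repeated random rounds -/

section HistoryLaw

variable {α β : Type*}

/-- The law of the history of the first `n` rounds (most recent round first) of a process whose
round `n`, given the history `h` so far, has the law `step n h`. -/
def historyLaw (step : ℕ → List α → PMF α) : ℕ → PMF (List α)
  | 0 => PMF.pure []
  | n + 1 => (historyLaw step n).bind fun h => (step n h).map (· :: h)

variable {step : ℕ → List α → PMF α}

theorem mem_support_historyLaw_succ {n : ℕ} {h : List α} :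
    h ∈ (historyLaw step (n + 1)).support ↔
      ∃ h' ∈ (historyLaw step n).support, ∃ a ∈ (step n h').support, a :: h' = h := by
  simp only [historyLaw, PMF.mem_support_bind_iff, PMF.mem_support_map_iff]

theorem historyLaw_induction {motive : ℕ → List α → Prop} (nil : motive 0 [])
    (cons : ∀ n, ∀ h ∈ (historyLaw step n).support, motive n h →
      ∀ a ∈ (step n h).support, motive (n + 1) (a :: h)) (n : ℕ) :
    ∀ h ∈ (historyLaw step n).support, motive n h := by
  induction n with
  | zero =>
    intro h hh
    rw [historyLaw, PMF.mem_support_pure_iff] at hh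
    exact hh ▸ nil
  | succ n ih =>
    rintro _ hcons
    obtain ⟨h, hh, a, ha, rfl⟩ := mem_support_historyLaw_succ.1 hcons
    exact cons n h hh (ih h hh) a ha

theorem length_of_mem_support_historyLaw {n : ℕ} {h : List α}
    (hh : h ∈ (historyLaw step n).support) : h.length = n :=
  historyLaw_induction (motive := fun n h => h.length = n) rfl
    (fun _ _ _ ih _ _ => by rw [List.length_cons, ih]) n h hh

theorem pmfExpect_historyLaw_succ {n : ℕ} {F : List α → ℝ}
    (hF : BoundedOnSupport F (historyLaw step (n + 1))) :
    pmfExpect (historyLaw step (n + 1)) F =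
      pmfExpect (historyLaw step n) fun h => pmfExpect (step n h) fun a => F (a :: h) := by
  rw [historyLaw] at hF ⊢
  rw [pmfExpect_bind hF]
  exact pmfExpect_congr fun h hh => pmfExpect_map (hF.of_bind hh)

theorem BoundedOnSupport.pmfExpect_step {n : ℕ} {F : List α → ℝ}
    (hF : BoundedOnSupport F (historyLaw step (n + 1))) :
    BoundedOnSupport (fun h => pmfExpect (step n h) fun a => F (a :: h)) (historyLaw step n) :=
  hF.imp fun _ hM h hh => abs_pmfExpect_le fun a ha =>
    hM _ (mem_support_historyLaw_succ.2 ⟨h, hh, a, ha, rfl⟩)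

theorem historyLaw_map {step' : ℕ → List β → PMF β} (o : α → β)
    (hstep : ∀ n h, (step n h).map o = step' n (h.map o)) (n : ℕ) :
    (historyLaw step n).map (List.map o) = historyLaw step' n := by
  induction n with
  | zero => simp only [historyLaw, PMF.pure_map, List.map_nil]
  | succ n ih =>
    simp only [historyLaw, ← ih, PMF.map_bind, PMF.bind_map, PMF.map_comp, Function.comp_def,
      ← hstep, List.map_cons]

section Additive

variable {f : ℕ → α → ℝ} {F : List α → ℝ} {B : ℝ} (hnil : F [] = 0)
  (hcons : ∀ a h, F (a :: h) = f h.length a + F h) (hf : ∀ n a, |f n a| ≤ B)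
include hnil hcons hf

theorem abs_additive_le (h : List α) : |F h| ≤ h.length * B := by
  induction h with
  | nil => simp [hnil]
  | cons a h ih =>
    rw [hcons, List.length_cons, Nat.cast_add_one, add_mul, one_mul, add_comm (_ * B)]
    exact (abs_add_le _ _).trans (add_le_add (hf _ _) ih)

theorem BoundedOnSupport.additive (n : ℕ) : BoundedOnSupport F (historyLaw step n) :=
  ⟨n * B, fun h hh => length_of_mem_support_historyLaw hh ▸ abs_additive_le hnil hcons hf h⟩

theorem pmfExpect_additive_succ (n : ℕ) :
    pmfExpect (historyLaw step (n + 1)) F = pmfExpect (historyLaw step n) F +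
      pmfExpect (historyLaw step n) fun h => pmfExpect (step n h) (f n) := by
  have hF := BoundedOnSupport.additive (step := step) hnil hcons hf
  have hb : ∀ p : PMF α, BoundedOnSupport (f n) p := fun p => ⟨B, fun a _ => hf n a⟩
  rw [pmfExpect_historyLaw_succ (hF _),
    ← pmfExpect_add (hF n) ⟨B, fun h _ => abs_pmfExpect_le fun a _ => hf n a⟩]
  refine pmfExpect_congr fun h hh => ?_
  simp only [hcons, length_of_mem_support_historyLaw hh]
  rw [pmfExpect_add (hb _) (.const _), pmfExpect_const, add_comm]

end Additive

end HistoryLaw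

section Feedback

variable {α : Type*}

/-- The joint law of a point drawn from `p` and of the feedback that it receives. -/
def feedbackLaw (p : PMF α) (fb : α → PMF ℝ) : PMF (α × ℝ) :=
  p.bind fun z => (fb z).map (Prod.mk z)

variable {p : PMF α} {fb : α → PMF ℝ}

theorem mem_support_feedbackLaw {w : α × ℝ} :
    w ∈ (feedbackLaw p fb).support ↔ w.1 ∈ p.support ∧ w.2 ∈ (fb w.1).support := by
  obtain ⟨z, r⟩ := w
  simp [feedbackLaw, and_comm]

theorem pmfExpect_feedbackLaw {F : α × ℝ → ℝ} (hF : BoundedOnSupport F (feedbackLaw p fb)) :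
    pmfExpect (feedbackLaw p fb) F = pmfExpect p fun z => pmfExpect (fb z) fun r => F (z, r) := by
  rw [feedbackLaw] at hF ⊢
  rw [pmfExpect_bind hF]
  exact pmfExpect_congr fun z hz => pmfExpect_map (hF.of_bind hz)

theorem BoundedOnSupport.comp_fst {G : α → ℝ} (hG : BoundedOnSupport G p) :
    BoundedOnSupport (fun w => G w.1) (feedbackLaw p fb) :=
  hG.imp fun _ hM w hw => hM w.1 (mem_support_feedbackLaw.1 hw).1

theorem pmfExpect_feedbackLaw_fst {G : α → ℝ} (hG : BoundedOnSupport G p) :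
    pmfExpect (feedbackLaw p fb) (fun w => G w.1) = pmfExpect p G := by
  rw [pmfExpect_feedbackLaw hG.comp_fst]
  simp only [pmfExpect_const]

variable {B : ℝ} (hfb : ∀ z, ∀ r ∈ (fb z).support, |r| ≤ B)
include hfb

theorem BoundedOnSupport.snd : BoundedOnSupport (fun w => w.2) (feedbackLaw p fb) :=
  ⟨B, fun w hw => hfb w.1 w.2 (mem_support_feedbackLaw.1 hw).2⟩

theorem pmfExpect_feedbackLaw_mul_snd {c : α → ℝ} (hc : BoundedOnSupport c p) :
    pmfExpect (feedbackLaw p fb) (fun w => c w.1 * w.2) =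
      pmfExpect p fun z => c z * pmfExpect (fb z) id := by
  rw [pmfExpect_feedbackLaw (hc.comp_fst.mul (.snd hfb))]
  exact pmfExpect_congr fun z _ => pmfExpect_const_mul _ (c z) id

end Feedback

namespace BanditEnvironment

variable {E : Type*} [AddCommGroup E] [Module ℝ E] {X : Set E} {B : ℝ}
  (env : BanditEnvironment X B) (R : Recommender X)

theorem play_eq_historyLaw (n : ℕ) :
    env.play R n = historyLaw (fun t h => feedbackLaw (R.recommend h) (env.feedback t)) n := by
  induction n with
  | zero => rfl
  | succ n ih =>
    simp only [play, historyLaw, feedbackLaw, ih, PMF.map_bind, PMF.map_comp]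
    rfl

theorem abs_payoff_le (t : ℕ) (z : X) : |env.payoff t z| ≤ B := by
  rw [← env.unbiased]
  exact abs_pmfExpect_le (env.bounded t z)

theorem pmfExpect_cumPayoff_succ (n : ℕ) :
    pmfExpect (env.play R (n + 1)) env.cumPayoff = pmfExpect (env.play R n) env.cumPayoff +
      pmfExpect (env.play R n) fun h => pmfExpect (R.recommend h) fun z => env.payoff n z := by
  simp only [play_eq_historyLaw]
  rw [pmfExpect_additive_succ (f := fun t w => env.payoff t w.1) rfl (fun _ _ => rfl)
    fun t w => env.abs_payoff_le t w.1]
  congr! 3 with h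
  exact pmfExpect_feedbackLaw_fst (G := fun z : X => env.payoff n z)
    ⟨B, fun z _ => env.abs_payoff_le n z⟩

theorem regret_le_two_mul (T : ℕ) (x : X) :
    ∑ t ∈ Finset.range T, env.payoff t x - pmfExpect (env.play R T) env.cumPayoff ≤
      2 * B * T := by
  have hcomparator : ∑ t ∈ Finset.range T, env.payoff t x ≤ T * B := by
    simpa using Finset.sum_le_card_nsmul (Finset.range T) _ B
      fun t _ => (abs_le.1 (env.abs_payoff_le t x)).2
  have hplayed : |pmfExpect (env.play R T) env.cumPayoff| ≤ T * B := by
    refine abs_pmfExpect_le fun h hh => ?_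
    rw [play_eq_historyLaw] at hh
    rw [← length_of_mem_support_historyLaw hh]
    exact abs_additive_le rfl (fun _ _ => rfl) (fun t w => env.abs_payoff_le t w.1) h
  linarith [(abs_le.1 hplayed).1]

end BanditEnvironment

/-! ### Exponential weights with least-squares loss estimates -/

open Matrix

theorem pmfExpect_dotProduct {α ι : Type*} [Fintype ι] {P : PMF α} {a : α → ι → ℝ}
    (ha : ∀ i, BoundedOnSupport (fun x => a x i) P) (v : ι → ℝ) :
    pmfExpect P (fun x => v ⬝ᵥ a x) = v ⬝ᵥ fun i => pmfExpect P fun x => a x i := by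
  simp (disch := fun_prop) only [dotProduct, pmfExpect_sum, pmfExpect_const_mul]

/-- The parameters of exponential weights with exploration for linear bandits on a set `α` of
actions with coordinates in a cube: the prior over the actions, the exploration distribution
`explore`, an upper bound `bound` for the feedback and the learning rates. The parameter `dim` is
at least the dimension and measures, through `coercive`, how well `explore` explores every
direction. -/
structure ExpWeights (α ι : Type*) [Fintype ι] where
  coord : α → ι → ℝ
  abs_coord_le : ∀ x i, |coord x i| ≤ 1
  prior : PMF α
  explore : PMF α
  dim : ℝ
  one_le_dim : 1 ≤ dim
  card_le_dim : Fintype.card ι ≤ dim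
  coercive : ∀ w : ι → ℝ, w ⬝ᵥ w ≤ dim * pmfExpect explore fun x => (w ⬝ᵥ coord x) ^ 2
  bound : ℝ
  bound_pos : 0 < bound
  rate : ℕ → ℝ
  rate_pos : ∀ n, 0 < rate n
  rate_anti : Antitone rate
  rate_le : ∀ n, rate n * dim ^ 2 * bound ≤ 1 / 2

namespace ExpWeights

variable {α ι : Type*} [Fintype ι] (A : ExpWeights α ι)

theorem dim_pos : 0 < A.dim := one_pos.trans_le A.one_le_dim

@[fun_prop]
theorem boundedOnSupport_coord (i : ι) (p : PMF α) : BoundedOnSupport (fun x => A.coord x i) p :=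
  ⟨1, fun x _ => A.abs_coord_le x i⟩

theorem abs_dotProduct_coord_le (θ : ι → ℝ) (x : α) : |θ ⬝ᵥ A.coord x| ≤ ∑ i, |θ i| := by
  refine (Finset.abs_sum_le_sum_abs _ _).trans (Finset.sum_le_sum fun i _ => ?_)
  rw [abs_mul]
  exact mul_le_of_le_one_right (abs_nonneg _) (A.abs_coord_le x i)

/-- The probability of exploration in round `n`. -/
def mixRate (n : ℕ) : ℝ := A.rate n * A.dim ^ 2 * A.bound

theorem mixRate_pos (n : ℕ) : 0 < A.mixRate n :=
  mul_pos (mul_pos (A.rate_pos n) (pow_pos A.dim_pos 2)) A.bound_pos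

theorem mixRate_le_half (n : ℕ) : A.mixRate n ≤ 1 / 2 := A.rate_le n

/-- The exponential weights distribution in round `n` for the estimated cumulative payoff `θ`. -/
def weights (n : ℕ) (θ : ι → ℝ) : PMF α :=
  pmfTilt A.prior (fun x => A.rate n * (θ ⬝ᵥ A.coord x)) (by fun_prop)

/-- The law of the action in round `n` for the estimated cumulative payoff `θ`. -/
def law (n : ℕ) (θ : ι → ℝ) : PMF α :=
  pmfMix (A.mixRate n) (A.mixRate_pos n).le ((A.mixRate_le_half n).trans one_half_lt_one.le)
    A.explore (A.weights n θ)

/-- The log-partition potential with learning rate `η`. -/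
def potential (η : ℝ) (θ : ι → ℝ) : ℝ :=
  logMeanExp A.prior (fun x => η * (θ ⬝ᵥ A.coord x)) / η

theorem abs_potential_le {η M : ℝ} (hη : 0 < η) {θ : ι → ℝ}
    (h : ∀ x, |θ ⬝ᵥ A.coord x| ≤ M) : |A.potential η θ| ≤ M := by
  rw [potential, abs_div, abs_of_pos hη, div_le_iff₀' hη]
  refine abs_logMeanExp_le fun x _ => ?_
  rw [abs_mul, abs_of_pos hη]
  exact mul_le_mul_of_nonneg_left (h x) hη.le

theorem potential_mono {η η' : ℝ} (hη : 0 < η) (hle : η ≤ η') (θ : ι → ℝ) :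
    A.potential η θ ≤ A.potential η' θ :=
  logMeanExp_div_mono (by fun_prop) hη hle

theorem mixRate_mul_le_pmfExpect_law (n : ℕ) (θ w : ι → ℝ) :
    A.mixRate n / A.dim * (w ⬝ᵥ w) ≤ pmfExpect (A.law n θ) fun x => (w ⬝ᵥ A.coord x) ^ 2 := by
  rw [law, pmfExpect_pmfMix (by fun_prop) (by fun_prop)]
  have hexplore : A.mixRate n / A.dim * (w ⬝ᵥ w) ≤
      A.mixRate n * pmfExpect A.explore fun x => (w ⬝ᵥ A.coord x) ^ 2 := by
    rw [div_mul_eq_mul_div, div_le_iff₀' A.dim_pos, mul_left_comm]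
    exact mul_le_mul_of_nonneg_left (A.coercive w) (A.mixRate_pos n).le
  have hweights : 0 ≤ pmfExpect (A.weights n θ) fun x => (w ⬝ᵥ A.coord x) ^ 2 :=
    pmfExpect_nonneg fun x => sq_nonneg _
  nlinarith [A.mixRate_le_half n]

theorem pmfExpect_weights_le_two_mul (n : ℕ) (θ : ι → ℝ) {F : α → ℝ}
    (hF : ∀ p, BoundedOnSupport F p) (h0 : ∀ x, 0 ≤ F x) :
    pmfExpect (A.weights n θ) F ≤ 2 * pmfExpect (A.law n θ) F := by
  rw [law, pmfExpect_pmfMix (hF _) (hF _)]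
  nlinarith [mul_nonneg (A.mixRate_pos n).le (pmfExpect_nonneg (p := A.explore) h0),
    mul_nonneg (sub_nonneg.2 (A.mixRate_le_half n)) (pmfExpect_nonneg (p := A.weights n θ) h0)]

theorem pmfExpect_weights_le_add (n : ℕ) (θ : ι → ℝ) {F : α → ℝ} {B : ℝ} (hF : ∀ x, |F x| ≤ B) :
    pmfExpect (A.weights n θ) F ≤ pmfExpect (A.law n θ) F + 2 * B * A.mixRate n := by
  rw [law, pmfExpect_pmfMix ⟨B, fun x _ => hF x⟩ ⟨B, fun x _ => hF x⟩]
  have hweights := (abs_le.1 (abs_pmfExpect_le (p := A.weights n θ) fun x _ => hF x)).2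
  have hexplore := (abs_le.1 (abs_pmfExpect_le (p := A.explore) fun x _ => hF x)).1
  nlinarith [A.mixRate_pos n]

variable [DecidableEq ι]

theorem isUnit_det_secondMoment (n : ℕ) (θ : ι → ℝ) :
    IsUnit (secondMoment (A.law n θ) A.coord).det := by
  refine isUnit_det_of_coercive (div_pos (A.mixRate_pos n) A.dim_pos) fun w => ?_
  simpa only [dotProduct_secondMoment_mulVec fun i => A.boundedOnSupport_coord i _, ← sq]
    using A.mixRate_mul_le_pmfExpect_law n θ w

/-- The direction in which a unit feedback for the action `z` in round `n` moves the least squares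
estimate of the payoff. -/
def direction (n : ℕ) (θ : ι → ℝ) (z : α) : ι → ℝ :=
  (secondMoment (A.law n θ) A.coord)⁻¹ *ᵥ A.coord z

@[fun_prop]
theorem boundedOnSupport_direction (n : ℕ) (θ : ι → ℝ) (i : ι) (p : PMF α) :
    BoundedOnSupport (fun z => A.direction n θ z i) p := by
  simp only [direction, mulVec]
  fun_prop

theorem abs_coord_dotProduct_direction_le (n : ℕ) (θ : ι → ℝ) (x z : α) :
    |A.coord x ⬝ᵥ A.direction n θ z| ≤ (A.rate n * A.bound)⁻¹ := by
  have hQ : ∀ w, A.mixRate n / A.dim * (w ⬝ᵥ w) ≤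
      w ⬝ᵥ secondMoment (A.law n θ) A.coord *ᵥ w := fun w => by
    simpa only [dotProduct_secondMoment_mulVec fun i => A.boundedOnSupport_coord i _, ← sq]
      using A.mixRate_mul_le_pmfExpect_law n θ w
  have hdim := A.dim_pos
  have hrate := A.rate_pos n
  have hbound := A.bound_pos
  calc |A.coord x ⬝ᵥ A.direction n θ z| ≤ Fintype.card ι / (A.mixRate n / A.dim) :=
        abs_dotProduct_inv_mulVec_le (div_pos (A.mixRate_pos n) hdim) hQ (A.abs_coord_le z)
          (A.abs_coord_le x)
    _ ≤ A.dim / (A.mixRate n / A.dim) := by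
        have := A.mixRate_pos n
        gcongr
        exact A.card_le_dim
    _ = (A.rate n * A.bound)⁻¹ := by
        rw [mixRate]
        field_simp

/-- The estimate of the cumulative payoff after round `n`, when `θ` is the estimate before that
round and `w` consists of the action played in it and of the feedback. -/
def update (n : ℕ) (θ : ι → ℝ) (w : α × ℝ) : ι → ℝ := θ + w.2 • A.direction n θ w.1

theorem update_dotProduct (n : ℕ) (θ v : ι → ℝ) (w : α × ℝ) :
    A.update n θ w ⬝ᵥ v = θ ⬝ᵥ v + (v ⬝ᵥ A.direction n θ w.1) * w.2 := by
  rw [update, add_dotProduct, smul_dotProduct, smul_eq_mul, dotProduct_comm v, mul_comm w.2]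

section Bounded

variable {n : ℕ} {θ : ι → ℝ} {w : α × ℝ} (hw : |w.2| ≤ A.bound)
include hw

theorem abs_coord_dotProduct_direction_mul_le (x : α) :
    |(A.coord x ⬝ᵥ A.direction n θ w.1) * w.2| ≤ (A.rate n)⁻¹ :=
  calc |(A.coord x ⬝ᵥ A.direction n θ w.1) * w.2| ≤ (A.rate n * A.bound)⁻¹ * A.bound := by
        rw [abs_mul]
        exact mul_le_mul (A.abs_coord_dotProduct_direction_le n θ x w.1) hw (abs_nonneg _)
          (inv_nonneg.2 (mul_pos (A.rate_pos n) A.bound_pos).le)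
    _ = (A.rate n)⁻¹ := by rw [mul_inv, inv_mul_cancel_right₀ A.bound_pos.ne']

theorem abs_update_dotProduct_le {M : ℝ} (h : ∀ x, |θ ⬝ᵥ A.coord x| ≤ M) (x : α) :
    |A.update n θ w ⬝ᵥ A.coord x| ≤ M + (A.rate n)⁻¹ := by
  rw [update_dotProduct]
  exact (abs_add_le _ _).trans
    (add_le_add (h x) (A.abs_coord_dotProduct_direction_mul_le hw x))

omit hw in
theorem pmfExpect_weights_direction_sq_le (z : α) :
    (pmfExpect (A.weights n θ) fun x => (A.coord x ⬝ᵥ A.direction n θ z) ^ 2) ≤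
      2 * (A.coord z ⬝ᵥ A.direction n θ z) := by
  have hsq : (pmfExpect (A.law n θ) fun x => (A.coord x ⬝ᵥ A.direction n θ z) ^ 2) =
      A.coord z ⬝ᵥ A.direction n θ z := by
    rw [direction, ← pmfExpect_leastSquares_sq (fun i => A.boundedOnSupport_coord i _)
      (A.isUnit_det_secondMoment n θ)]
    simp only [dotProduct_inv_secondMoment_mulVec_comm, dotProduct_comm]
  rw [← hsq]
  exact A.pmfExpect_weights_le_two_mul n θ (fun p => by fun_prop) fun x => sq_nonneg _

theorem logMeanExp_weights_le :
    logMeanExp (A.weights n θ) (fun x => A.rate n * ((A.coord x ⬝ᵥ A.direction n θ w.1) * w.2)) ≤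
      A.rate n * (((fun i => pmfExpect (A.weights n θ) fun x => A.coord x i) ⬝ᵥ
        A.direction n θ w.1) * w.2 +
        2 * A.rate n * A.bound ^ 2 * (A.coord w.1 ⬝ᵥ A.direction n θ w.1)) := by
  set η := A.rate n
  have hη : 0 < η := A.rate_pos n
  set d := A.direction n θ w.1
  have hle_one : ∀ x ∈ (A.weights n θ).support, |η * w.2 * (d ⬝ᵥ A.coord x)| ≤ 1 := fun x _ =>
    calc |η * w.2 * (d ⬝ᵥ A.coord x)| = η * |(A.coord x ⬝ᵥ d) * w.2| := by
          rw [mul_assoc, abs_mul, abs_of_pos hη, mul_comm w.2, dotProduct_comm]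
      _ ≤ η * η⁻¹ := by
          gcongr
          exact A.abs_coord_dotProduct_direction_mul_le hw x
      _ = 1 := mul_inv_cancel₀ hη.ne'
  have hsq : w.2 ^ 2 * (pmfExpect (A.weights n θ) fun x => (d ⬝ᵥ A.coord x) ^ 2) ≤
      A.bound ^ 2 * (2 * (A.coord w.1 ⬝ᵥ d)) := by
    simp only [dotProduct_comm d]
    exact mul_le_mul (sq_le_sq' (abs_le.1 hw).1 (abs_le.1 hw).2)
      (A.pmfExpect_weights_direction_sq_le w.1) (pmfExpect_nonneg fun x => sq_nonneg _)
      (sq_nonneg _)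
  have hcumulant := logMeanExp_le_add_sq hle_one
  simp only [mul_pow] at hcumulant
  rw [pmfExpect_const_mul, pmfExpect_const_mul,
    pmfExpect_dotProduct fun i => A.boundedOnSupport_coord i _] at hcumulant
  have hcomm : ∀ x, η * ((A.coord x ⬝ᵥ d) * w.2) = η * w.2 * (d ⬝ᵥ A.coord x) := fun x => by
    rw [dotProduct_comm, mul_assoc, mul_comm w.2]
  simp only [hcomm]
  rw [dotProduct_comm _ d]
  nlinarith [mul_le_mul_of_nonneg_left hsq (sq_nonneg η)]

theorem potential_update_le :
    A.potential (A.rate n) (A.update n θ w) ≤ A.potential (A.rate n) θ +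
      ((fun i => pmfExpect (A.weights n θ) fun x => A.coord x i) ⬝ᵥ A.direction n θ w.1) * w.2 +
      2 * A.rate n * A.bound ^ 2 * (A.coord w.1 ⬝ᵥ A.direction n θ w.1) := by
  simp only [potential, update_dotProduct, mul_add (A.rate n)]
  rw [logMeanExp_add (by fun_prop) (by fun_prop), add_div, add_assoc]
  gcongr
  rw [div_le_iff₀' (A.rate_pos n)]
  exact A.logMeanExp_weights_le hw

end Bounded

section Feedback

variable {n : ℕ} {θ : ι → ℝ} {g : ι → ℝ} {fb : α → PMF ℝ}
  (hfb : ∀ z, ∀ r ∈ (fb z).support, |r| ≤ A.bound)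
  (hg : ∀ z, pmfExpect (fb z) id = g ⬝ᵥ A.coord z)
include hfb hg

theorem pmfExpect_direction_mul_feedback (v : ι → ℝ) :
    pmfExpect (feedbackLaw (A.law n θ) fb) (fun w => (v ⬝ᵥ A.direction n θ w.1) * w.2) =
      v ⬝ᵥ g := by
  rw [pmfExpect_feedbackLaw_mul_snd (c := fun z => v ⬝ᵥ A.direction n θ z) hfb (by fun_prop)]
  simp only [hg]
  exact pmfExpect_leastSquares (fun i => A.boundedOnSupport_coord i _)
    (A.isUnit_det_secondMoment n θ) v g

theorem pmfExpect_update_dotProduct (v : ι → ℝ) :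
    pmfExpect (feedbackLaw (A.law n θ) fb) (fun w => A.update n θ w ⬝ᵥ v) = θ ⬝ᵥ v + g ⬝ᵥ v := by
  have hdir : BoundedOnSupport (fun z => v ⬝ᵥ A.direction n θ z) (A.law n θ) := by fun_prop
  simp only [update_dotProduct]
  rw [pmfExpect_add (.const _) (hdir.comp_fst.mul (.snd hfb)), pmfExpect_const,
    A.pmfExpect_direction_mul_feedback hfb hg, dotProduct_comm g]

theorem pmfExpect_potential_update_le :
    pmfExpect (feedbackLaw (A.law n θ) fb) (fun w => A.potential (A.rate n) (A.update n θ w)) ≤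
    A.potential (A.rate n) θ + (pmfExpect (A.law n θ) fun z => g ⬝ᵥ A.coord z) +
      4 * A.dim ^ 2 * A.bound ^ 2 * A.rate n := by
  set mean : ι → ℝ := fun i => pmfExpect (A.weights n θ) fun x => A.coord x i
  have hlinear := (BoundedOnSupport.comp_fst (fb := fb) (p := A.law n θ)
    (G := fun z => mean ⬝ᵥ A.direction n θ z) (by fun_prop)).mul (.snd hfb)
  have hvariance := BoundedOnSupport.comp_fst (fb := fb) (p := A.law n θ)
    (G := fun z => A.coord z ⬝ᵥ A.direction n θ z) (by fun_prop)
  have hpotential : BoundedOnSupport (fun w => A.potential (A.rate n) (A.update n θ w))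
      (feedbackLaw (A.law n θ) fb) :=
    ⟨_, fun w hw => A.abs_potential_le (A.rate_pos n)
      (A.abs_update_dotProduct_le (hfb _ _ (mem_support_feedbackLaw.1 hw).2)
        (A.abs_dotProduct_coord_le θ))⟩
  have hmean : mean ⬝ᵥ g ≤ (pmfExpect (A.law n θ) fun z => g ⬝ᵥ A.coord z) +
      2 * A.bound * A.mixRate n := by
    rw [dotProduct_comm, ← pmfExpect_dotProduct fun i => A.boundedOnSupport_coord i _]
    exact A.pmfExpect_weights_le_add n θ fun x => hg x ▸ abs_pmfExpect_le (hfb x)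
  have hcard : (Fintype.card ι : ℝ) ≤ A.dim ^ 2 :=
    A.card_le_dim.trans (le_self_pow₀ A.one_le_dim two_ne_zero)
  have hcoef : 0 ≤ 2 * A.rate n * A.bound ^ 2 := by have := A.rate_pos n; positivity
  calc _ ≤ pmfExpect (feedbackLaw (A.law n θ) fb) fun w => A.potential (A.rate n) θ +
          (mean ⬝ᵥ A.direction n θ w.1) * w.2 +
          2 * A.rate n * A.bound ^ 2 * (A.coord w.1 ⬝ᵥ A.direction n θ w.1) :=
        pmfExpect_mono hpotential (by fun_prop) fun w hw =>
          A.potential_update_le (hfb _ _ (mem_support_feedbackLaw.1 hw).2)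
    _ = A.potential (A.rate n) θ + mean ⬝ᵥ g +
          2 * A.rate n * A.bound ^ 2 * Fintype.card ι := by
        rw [pmfExpect_add (by fun_prop) (by fun_prop), pmfExpect_add (by fun_prop) hlinear,
          pmfExpect_const, pmfExpect_const_mul, A.pmfExpect_direction_mul_feedback hfb hg,
          pmfExpect_feedbackLaw_fst (G := fun z => A.coord z ⬝ᵥ A.direction n θ z) (by fun_prop)]
        congr 2
        exact pmfExpect_dotProduct_inv_secondMoment (fun i => A.boundedOnSupport_coord i _)
          (A.isUnit_det_secondMoment n θ)
    _ ≤ _ := by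
        have := mul_le_mul_of_nonneg_left hcard hcoef
        rw [mixRate] at hmean
        linarith

end Feedback

end ExpWeights

namespace ExpWeights

section Recommender

variable {E : Type*} [AddCommGroup E] [Module ℝ E] {X : Set E} {ι : Type*} [Fintype ι]
  [DecidableEq ι] (A : ExpWeights X ι)

/-- The estimate of the cumulative payoff after a history, most recent round first. -/
def estimate : List (X × ℝ) → ι → ℝ
  | [] => 0
  | w :: h => A.update h.length (estimate h) w

/-- The recommender that plays the exponential weights distribution with exploration. -/
def recommender : Recommender X where
  recommend h := A.law h.length (A.estimate h)

variable (env : BanditEnvironment X A.bound)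

theorem play_recommender (n : ℕ) :
    env.play A.recommender n =
      historyLaw (fun t h => feedbackLaw (A.law h.length (A.estimate h)) (env.feedback t)) n :=
  env.play_eq_historyLaw A.recommender n

theorem abs_estimate_dotProduct_le (n : ℕ) :
    ∀ h ∈ (env.play A.recommender n).support, ∀ x,
      |A.estimate h ⬝ᵥ A.coord x| ≤ ∑ t ∈ Finset.range n, (A.rate t)⁻¹ := by
  rw [play_recommender]
  refine historyLaw_induction (motive := fun n h => ∀ x,
    |A.estimate h ⬝ᵥ A.coord x| ≤ ∑ t ∈ Finset.range n, (A.rate t)⁻¹)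
    (fun x => by simp [estimate]) (fun n h hh ih w hw x => ?_) n
  rw [estimate, Finset.sum_range_succ, length_of_mem_support_historyLaw hh]
  exact A.abs_update_dotProduct_le (env.bounded n _ _ (mem_support_feedbackLaw.1 hw).2) ih x

theorem boundedOnSupport_estimate (n : ℕ) (x : X) :
    BoundedOnSupport (fun h => A.estimate h ⬝ᵥ A.coord x) (env.play A.recommender n) :=
  ⟨_, fun h hh => A.abs_estimate_dotProduct_le env n h hh x⟩

theorem boundedOnSupport_potential (n : ℕ) {η : ℝ} (hη : 0 < η) :
    BoundedOnSupport (fun h => A.potential η (A.estimate h)) (env.play A.recommender n) :=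
  ⟨_, fun h hh => A.abs_potential_le hη (A.abs_estimate_dotProduct_le env n h hh)⟩

variable {g : ℕ → ι → ℝ} (hg : ∀ t (x : X), env.payoff t x = g t ⬝ᵥ A.coord x)
include hg

theorem pmfExpect_estimate (n : ℕ) (x : X) :
    (pmfExpect (env.play A.recommender n) fun h => A.estimate h ⬝ᵥ A.coord x) =
      ∑ t ∈ Finset.range n, env.payoff t x := by
  induction n with
  | zero => simp [BanditEnvironment.play, pmfExpect_pure, estimate]
  | succ n ih =>
    have hestimate := A.boundedOnSupport_estimate env
    rw [Finset.sum_range_succ, ← ih, ← pmfExpect_const (env.play A.recommender n) (env.payoff n x),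
      ← pmfExpect_add (hestimate n x) (.const _)]
    simp only [play_recommender] at hestimate ⊢
    rw [pmfExpect_historyLaw_succ (hestimate (n + 1) x)]
    refine pmfExpect_congr fun h hh => ?_
    simp only [estimate, length_of_mem_support_historyLaw hh]
    rw [A.pmfExpect_update_dotProduct (env.bounded n)
      (fun z => (env.unbiased n z).trans (hg n z)), hg]

theorem pmfExpect_potential_succ_le (n : ℕ) :
    (pmfExpect (env.play A.recommender (n + 1)) fun h => A.potential (A.rate n) (A.estimate h)) ≤
      (pmfExpect (env.play A.recommender n) fun h => A.potential (A.rate n) (A.estimate h)) +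
      (pmfExpect (env.play A.recommender n) fun h =>
        pmfExpect (A.recommender.recommend h) fun z => env.payoff n z) +
      4 * A.dim ^ 2 * A.bound ^ 2 * A.rate n := by
  have hpotential := fun m => A.boundedOnSupport_potential env m (A.rate_pos n)
  have hpayoff : BoundedOnSupport (fun h =>
      pmfExpect (A.recommender.recommend h) fun z => env.payoff n z)
      (env.play A.recommender n) :=
    ⟨A.bound, fun h _ => abs_pmfExpect_le fun z _ => env.abs_payoff_le n z⟩
  rw [← pmfExpect_add (hpotential n) hpayoff,
    ← pmfExpect_const (env.play A.recommender n) (4 * A.dim ^ 2 * A.bound ^ 2 * A.rate n),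
    ← pmfExpect_add ((hpotential n).add hpayoff) (.const _)]
  simp only [play_recommender] at hpotential hpayoff ⊢
  rw [pmfExpect_historyLaw_succ (hpotential (n + 1))]
  refine pmfExpect_mono (hpotential (n + 1)).pmfExpect_step
    (((hpotential n).add hpayoff).add (.const _)) fun h hh => ?_
  simp only [estimate, recommender, length_of_mem_support_historyLaw hh, hg]
  exact A.pmfExpect_potential_update_le (env.bounded n)
    fun z => (env.unbiased n z).trans (hg n z)

theorem pmfExpect_potential_le (n : ℕ) :
    (pmfExpect (env.play A.recommender n) fun h => A.potential (A.rate n) (A.estimate h)) ≤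
      pmfExpect (env.play A.recommender n) env.cumPayoff +
        4 * A.dim ^ 2 * A.bound ^ 2 * ∑ t ∈ Finset.range n, A.rate t := by
  induction n with
  | zero =>
    simp [BanditEnvironment.play, pmfExpect_pure, estimate, potential, logMeanExp,
      BanditEnvironment.cumPayoff, pmfExpect_const]
  | succ n ih =>
    have hdecrease : (pmfExpect (env.play A.recommender (n + 1)) fun h =>
        A.potential (A.rate (n + 1)) (A.estimate h)) ≤
        pmfExpect (env.play A.recommender (n + 1)) fun h => A.potential (A.rate n) (A.estimate h) :=
      pmfExpect_mono (A.boundedOnSupport_potential env _ (A.rate_pos _))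
        (A.boundedOnSupport_potential env _ (A.rate_pos _)) fun h _ =>
          A.potential_mono (A.rate_pos _) (A.rate_anti n.le_succ) _
    rw [env.pmfExpect_cumPayoff_succ, Finset.sum_range_succ]
    linarith [A.pmfExpect_potential_succ_le env hg n]

theorem regret_le_of_mem_support (n : ℕ) {x : X} (hx : x ∈ A.prior.support) :
    ∑ t ∈ Finset.range n, env.payoff t x - pmfExpect (env.play A.recommender n) env.cumPayoff ≤
      -Real.log (A.prior x).toReal / A.rate n +
        4 * A.dim ^ 2 * A.bound ^ 2 * ∑ t ∈ Finset.range n, A.rate t := by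
  have hη := A.rate_pos n
  have hestimate := A.boundedOnSupport_estimate env n x
  have hpointwise : ∀ θ : ι → ℝ, θ ⬝ᵥ A.coord x + Real.log (A.prior x).toReal / A.rate n ≤
      A.potential (A.rate n) θ := fun θ => by
    rw [potential, le_div_iff₀ hη, add_mul, div_mul_cancel₀ _ hη.ne', mul_comm]
    exact add_log_apply_le_logMeanExp (F := fun x => A.rate n * (θ ⬝ᵥ A.coord x)) (by fun_prop) hx
  have hmean := pmfExpect_mono (hestimate.add (.const _))
    (A.boundedOnSupport_potential env n hη) fun h _ => hpointwise (A.estimate h)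
  rw [pmfExpect_add hestimate (.const _), pmfExpect_const, A.pmfExpect_estimate env hg] at hmean
  rw [neg_div]
  linarith [A.pmfExpect_potential_le env hg n]

end Recommender

end ExpWeights

theorem exists_exploration {α : Type*} [Nonempty α] {d : ℕ} {b : Fin d → α} {coord : α → Fin d → ℝ}
    (hcoord : ∀ x i, |coord x i| ≤ 1) (hb : ∀ i, coord (b i) = Pi.single i 1) :
    ∃ ν : PMF α, ∀ w : Fin d → ℝ, w ⬝ᵥ w = d * pmfExpect ν fun x => (w ⬝ᵥ coord x) ^ 2 := by
  rcases Nat.eq_zero_or_pos d with rfl | hd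
  · exact ⟨PMF.pure (Classical.arbitrary α), fun w => by simp [dotProduct]⟩
  have : NeZero d := ⟨hd.ne'⟩
  have hbounded : ∀ i p, BoundedOnSupport (fun x => coord x i) p := fun i p =>
    ⟨1, fun x _ => hcoord x i⟩
  refine ⟨(PMF.uniformOfFintype (Fin d)).map b, fun w => ?_⟩
  rw [pmfExpect_map (by fun_prop), pmfExpect_fintype]
  simp only [hb, dotProduct_single, mul_one, PMF.uniformOfFintype_apply, Fintype.card_fin,
    ENNReal.toReal_inv, ENNReal.toReal_natCast, ← Finset.mul_sum]
  rw [mul_inv_cancel_left₀ (NeZero.ne _)]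
  simp only [dotProduct, sq]

theorem dotProduct_le_add_card_mul {ι : Type*} [Fintype ι] {g x y : ι → ℝ} {b ε : ℝ}
    (hg : ∀ i, |g i| ≤ b) (hxy : ∀ i, |x i - y i| ≤ ε) :
    g ⬝ᵥ x ≤ g ⬝ᵥ y + Fintype.card ι * (b * ε) := by
  rw [← sub_le_iff_le_add', ← dotProduct_sub, ← nsmul_eq_mul, ← Finset.card_univ]
  refine Finset.sum_le_card_nsmul _ _ _ fun i _ => (le_abs_self _).trans ?_
  rw [abs_mul]
  exact mul_le_mul (hg i) (hxy i) (abs_nonneg _) ((abs_nonneg _).trans (hg i))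

namespace ExpWeights

section Net

theorem exists_mem_support_near {α ι : Type*} [Fintype ι] (A : ExpWeights α ι)
    (hprior : IsNetPrior A.coord A.prior) {T : ℕ} (hT : 2 ≤ T) (x : α) :
    ∃ x' ∈ A.prior.support, (∀ i, |A.coord x i - A.coord x' i| ≤ 1 / T) ∧
      -Real.log (A.prior x').toReal ≤ 8 * A.dim * Real.log T := by
  obtain ⟨k, hTk, hk⟩ := exists_le_two_pow hT
  obtain ⟨x', hclose, hmass⟩ := hprior k x
  have hTpos : (0 : ℝ) < T := by positivity
  refine ⟨x', ((ENNReal.pow_pos (by simp) _).trans_le hmass).ne',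
    fun i => (hclose i).trans (one_div_le_one_div_of_le hTpos hTk),
    (neg_log_toReal_le (A.prior.apply_ne_top x') hmass).trans ?_⟩
  have hcount : ((k : ℝ) + 1) + Fintype.card ι * (k + 2) ≤ 2 * A.dim * (k + 2) := by
    nlinarith [A.one_le_dim, A.card_le_dim, k.cast_nonneg (α := ℝ)]
  push_cast
  calc _ ≤ 2 * A.dim * (k + 2) * Real.log 2 := by gcongr
    _ = 2 * A.dim * ((k + 2) * Real.log 2) := by ring
    _ ≤ 2 * A.dim * (4 * Real.log T) := by have := A.dim_pos; gcongr
    _ = _ := by ring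

variable {E : Type*} [AddCommGroup E] [Module ℝ E] {X : Set E} {ι : Type*} [Fintype ι]
  (A : ExpWeights X ι) (env : BanditEnvironment X A.bound)
  {g : ℕ → ι → ℝ} (hg : ∀ t (x : X), env.payoff t x = g t ⬝ᵥ A.coord x)
  (hgB : ∀ t i, |g t i| ≤ A.bound) {T : ℕ}
include hg hgB

theorem sum_payoff_le_add (hT : T ≠ 0) {x x' : X}
    (hclose : ∀ i, |A.coord x i - A.coord x' i| ≤ 1 / T) :
    ∑ t ∈ Finset.range T, env.payoff t x ≤
      ∑ t ∈ Finset.range T, env.payoff t x' + A.bound * A.dim := by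
  calc _ ≤ ∑ t ∈ Finset.range T, (env.payoff t x' + A.dim * (A.bound * (1 / T))) := by
        refine Finset.sum_le_sum fun t _ => ?_
        rw [hg, hg]
        refine (dotProduct_le_add_card_mul (hgB t) hclose).trans ?_
        have := A.bound_pos
        gcongr
        exact A.card_le_dim
    _ = _ := by
        rw [Finset.sum_add_distrib, Finset.sum_const, Finset.card_range, nsmul_eq_mul]
        field_simp

theorem regret_le_of_isNetPrior [DecidableEq ι] (hprior : IsNetPrior A.coord A.prior)
    (hrate : A.rate = anytimeRate A.dim A.bound) (hT : 2 ≤ T) (x : X) :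
    ∑ t ∈ Finset.range T, env.payoff t x - pmfExpect (env.play A.recommender T) env.cumPayoff ≤
      50 * A.bound * (A.dim * √A.dim) * √(T * Real.log T) := by
  have hB := A.bound_pos
  have hm := A.dim_pos
  rcases lt_or_ge (T : ℝ) (A.dim ^ 3 * Real.log T) with hsmall | hlarge
  · have htrivial := mul_le_mul_of_nonneg_left
      (le_mul_sqrt_mul_sqrt hm.le T.cast_nonneg hsmall.le) hB.le
    linarith [env.regret_le_two_mul A.recommender T x, mul_nonneg hB.le T.cast_nonneg]
  obtain ⟨x', hx', hclose, hmass⟩ := A.exists_mem_support_near hprior hT x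
  have hnet := A.sum_payoff_le_add env hg hgB (by omega) hclose
  have hdim : A.bound * A.dim ≤ A.bound * (A.dim * √A.dim * √(T * Real.log T)) := by
    gcongr
    rw [mul_assoc]
    exact le_mul_of_one_le_right hm.le (one_le_mul_of_one_le_of_one_le
      (Real.one_le_sqrt.2 A.one_le_dim) (one_le_sqrt_mul_log hT))
  have hpenalty := div_le_div_of_nonneg_right hmass (A.rate_pos T).le
  have hlog := log_mul_inv_anytimeRate_le hT hm hB hlarge
  have hsum := sum_anytimeRate_le hT hm hB
  rw [← hrate] at hlog hsum
  rw [div_eq_mul_inv (8 * A.dim * _)] at hpenalty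
  linarith [A.regret_le_of_mem_support env hg T hx', mul_pos hB hm]

end Net

end ExpWeights

theorem exists_isRegretMinimizer {E : Type*} [NormedAddCommGroup E] [NormedSpace ℝ E]
    [FiniteDimensional ℝ E] {X : Set E} (hX : IsCompact X) (hne : X.Nonempty) {m B : ℝ}
    (hm : 1 ≤ m) (hdim : Module.finrank ℝ E ≤ m) (hB : 0 ≤ B) :
    ∃ R : Recommender X,
      R.IsRegretMinimizer B fun T => 50 * B * (m * √m) * √(T * Real.log T) := by
  have : Nonempty X := hne.to_subtype
  rcases hB.eq_or_lt with rfl | hB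
  · refine ⟨⟨fun _ => PMF.pure (Classical.arbitrary X)⟩, fun env T _ x hx => ?_⟩
    simpa using env.regret_le_two_mul _ T ⟨x, hx⟩
  obtain ⟨d, b, coord, hd, hcoord, hrepr, hb⟩ := exists_barycentric_spanner hX
  have hdm : (d : ℝ) ≤ m := (Nat.cast_le.2 hd).trans hdim
  have hm0 : 0 < m := one_pos.trans_le hm
  obtain ⟨ν, hν⟩ := exists_exploration hcoord hb
  obtain ⟨π, hπ⟩ := exists_isNetPrior hcoord
  let A : ExpWeights X (Fin d) :=
    { coord := coord
      abs_coord_le := hcoord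
      prior := π
      explore := ν
      dim := m
      one_le_dim := hm
      card_le_dim := by simpa using hdm
      coercive := fun w => (hν w).le.trans
        (mul_le_mul_of_nonneg_right hdm (pmfExpect_nonneg fun x => sq_nonneg _))
      bound := B
      bound_pos := hB
      rate := anytimeRate m B
      rate_pos := anytimeRate_pos hm0 hB
      rate_anti := anytimeRate_antitone hB
      rate_le := anytimeRate_mul_le hm0 hB }
  refine ⟨A.recommender, fun env T hT x hx => A.regret_le_of_isNetPrior env
    (g := fun t i => env.payoff t (b i)) (fun t z => ?_) (fun t i => env.abs_payoff_le t (b i))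
    hπ rfl hT ⟨x, hx⟩⟩
  conv_lhs => rw [hrepr z, map_sum]
  simp only [map_smul, smul_eq_mul, dotProduct, mul_comm, A]

/-! ### The persuasion algorithm -/

namespace PersuasionProblem

section PersuasiveSchemes

variable {C Y : Type*} [Fintype C]

/-- The Receiver's expected gain, on the event that `y` is recommended, from responding with `y'`
instead, as a linear functional of the conditional response probabilities. -/
def deviationGain (I : PersuasionProblem C Y) (y y' : Y) : (C → Y → ℝ) →ₗ[ℝ] ℝ :=
  ∑ c, ((I.prior c).toReal * (I.u c y' - I.u c y)) •
    ((LinearMap.proj y : (Y → ℝ) →ₗ[ℝ] ℝ) ∘ₗ LinearMap.proj c)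

variable (I : PersuasionProblem C Y)

theorem deviationGain_apply (y y' : Y) (w : C → Y → ℝ) :
    I.deviationGain y y' w = ∑ c, (I.prior c).toReal * w c y * (I.u c y' - I.u c y) := by
  simp only [deviationGain, LinearMap.sum_apply, LinearMap.smul_apply, LinearMap.comp_apply,
    LinearMap.proj_apply, smul_eq_mul, mul_right_comm]

theorem signalProb_nonneg (φ : DirectScheme C Y) (y : Y) : 0 ≤ I.signalProb φ y :=
  Finset.sum_nonneg fun _ _ => mul_nonneg ENNReal.toReal_nonneg ENNReal.toReal_nonneg

theorem signalProb_mul_posterior (φ : DirectScheme C Y) (y : Y) (c : C) :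
    I.signalProb φ y * I.posterior φ y c = (I.prior c).toReal * (φ c y).toReal := by
  refine mul_div_cancel_of_imp' fun h0 => ?_
  exact (Finset.sum_eq_zero_iff_of_nonneg fun c _ =>
    mul_nonneg ENNReal.toReal_nonneg ENNReal.toReal_nonneg).1 h0 c (Finset.mem_univ c)

theorem deviationGain_eq_signalProb_mul (φ : DirectScheme C Y) (y y' : Y) :
    I.deviationGain y y' (fun c y => (φ c y).toReal) = I.signalProb φ y *
      (∑ c, I.posterior φ y c * I.u c y' - ∑ c, I.posterior φ y c * I.u c y) := by
  simp only [deviationGain_apply, ← Finset.sum_sub_distrib, ← mul_sub, Finset.mul_sum, ← mul_assoc,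
    signalProb_mul_posterior]

variable [Fintype Y]

/-- The polytope of persuasive direct schemes, as a set of real matrices: the conditional
response probabilities satisfying the incentive constraints, from which the normalization of the
posterior is cleared. -/
def persuasivePolytope : Set (C → Y → ℝ) :=
  (Set.univ.pi fun _ => stdSimplex ℝ Y) ∩ ⋂ (y) (y'), {w | I.deviationGain y y' w ≤ 0}

theorem toReal_mem_stdSimplex (p : PMF Y) : (fun y => (p y).toReal) ∈ stdSimplex ℝ Y :=
  ⟨fun _ => ENNReal.toReal_nonneg, by simpa only [tsum_fintype] using tsum_toReal_pmf p⟩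

theorem exists_pmf_toReal_eq {w : Y → ℝ} (hw : w ∈ stdSimplex ℝ Y) :
    ∃ p : PMF Y, (fun y => (p y).toReal) = w := by
  refine ⟨PMF.ofFintype (fun y => ENNReal.ofReal (w y)) ?_, funext fun y => ?_⟩
  · rw [← ENNReal.ofReal_sum_of_nonneg fun y _ => hw.1 y, hw.2, ENNReal.ofReal_one]
  · rw [PMF.ofFintype_apply, ENNReal.toReal_ofReal (hw.1 y)]

theorem isCompact_persuasivePolytope : IsCompact I.persuasivePolytope :=
  (isCompact_univ_pi fun _ => isCompact_stdSimplex ℝ Y).inter_right <|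
    isClosed_iInter fun _ => isClosed_iInter fun _ =>
      isClosed_le (LinearMap.continuous_of_finiteDimensional _) continuous_const

theorem convex_persuasivePolytope : Convex ℝ I.persuasivePolytope :=
  (convex_pi fun _ _ => convex_stdSimplex ℝ Y).inter <|
    convex_iInter fun _ => convex_iInter fun _ => convex_halfSpace_le (LinearMap.isLinear _) 0

theorem mem_persuasiveSchemes_iff (φ : DirectScheme C Y) :
    φ ∈ I.persuasiveSchemes ↔ (fun c y => (φ c y).toReal) ∈ I.persuasivePolytope := by
  simp only [persuasivePolytope, Set.mem_inter_iff, Set.mem_univ_pi, toReal_mem_stdSimplex,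
    implies_true, true_and, Set.mem_iInter, Set.mem_ofPred_eq, deviationGain_eq_signalProb_mul]
  refine forall_congr' fun y => ?_
  rcases (I.signalProb_nonneg φ y).eq_or_lt with h0 | hpos
  · simp [← h0]
  · simp [hpos, hpos.le, bestResponses, mul_nonpos_iff_pos_imp_nonpos]

theorem image_persuasiveSchemes :
    (fun (φ : DirectScheme C Y) c y => (φ c y).toReal) '' I.persuasiveSchemes =
      I.persuasivePolytope := by
  refine Set.Subset.antisymm ?_ fun w hw => ?_
  · rintro _ ⟨φ, hφ, rfl⟩
    exact (I.mem_persuasiveSchemes_iff φ).1 hφ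
  · choose φ hφ using fun c => exists_pmf_toReal_eq (hw.1 c trivial)
    obtain rfl : (fun c y => (φ c y).toReal) = w := funext hφ
    exact ⟨φ, (I.mem_persuasiveSchemes_iff φ).2 hw, rfl⟩

theorem image_embed_persuasiveSchemes :
    I.embed '' I.persuasiveSchemes = I.embedLinear '' I.persuasivePolytope := by
  rw [← image_persuasiveSchemes, Set.image_image]
  rfl

end PersuasiveSchemes

section Hull

variable {C Y : Type*} [Fintype C] [Finite Y] (I : PersuasionProblem C Y)

theorem persuasiveSchemes_nonempty [Nonempty Y] : I.persuasiveSchemes.Nonempty := by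
  classical
  cases nonempty_fintype Y
  -- Recommending the best response to the prior, whatever the item, is persuasive.
  obtain ⟨y₀, hy₀⟩ := Finite.exists_max fun y => ∑ c, (I.prior c).toReal * I.u c y
  refine ⟨fun _ => PMF.pure y₀, (I.mem_persuasiveSchemes_iff _).2
    ⟨fun c _ => toReal_mem_stdSimplex _, Set.mem_iInter₂.2 fun y y' => ?_⟩⟩
  rw [Set.mem_ofPred_eq, deviationGain_apply]
  by_cases h : y = y₀
  · subst h
    simpa [mul_sub] using hy₀ y'
  · simp [PMF.pure_apply_of_ne _ _ h]

theorem isCompact_image_embed : IsCompact (I.embed '' I.persuasiveSchemes) := by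
  cases nonempty_fintype Y
  rw [image_embed_persuasiveSchemes]
  exact I.isCompact_persuasivePolytope.image (LinearMap.continuous_of_finiteDimensional _)

theorem hull_eq_image_embed : I.hull = I.embed '' I.persuasiveSchemes := by
  cases nonempty_fintype Y
  rw [hull, image_embed_persuasiveSchemes]
  exact (I.convex_persuasivePolytope.linear_image I.embedLinear).convexHull_eq

theorem isCompact_hull : IsCompact I.hull := I.hull_eq_image_embed ▸ I.isCompact_image_embed

theorem hull_nonempty [Nonempty Y] : I.hull.Nonempty :=
  I.hull_eq_image_embed ▸ I.persuasiveSchemes_nonempty.image _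

end Hull

section Decomposition

variable {C Y : Type*} [Fintype C] [Fintype Y] (I : PersuasionProblem C Y)

/- Since `f(𝒫)` is already convex, a single scheme, repeated `m + 1` times, represents a point of
the hull. -/
theorem nonempty_decomposition : Nonempty I.Decomposition := by
  have hsurj : ∀ z : I.hull, ∃ φ : I.persuasiveSchemes, I.embed φ = z := by
    rintro ⟨z, hz⟩
    rw [hull_eq_image_embed] at hz
    obtain ⟨φ, hφ, rfl⟩ := hz
    exact ⟨⟨φ, hφ⟩, rfl⟩
  choose φ hφ using hsurj
  refine ⟨⟨fun z _ => φ z, fun _ => PMF.pure 0, fun z => ?_⟩⟩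
  rw [← Finset.sum_smul, (toReal_mem_stdSimplex _).2, one_smul, hφ]

/-- The linear payoff `z ↦ -∑ y, z y`, which recovers the Advisor's utility `v(φ)` from `f(φ)`. -/
def utilityFunctional (Y : Type*) [Fintype Y] : (Y → ℝ) →ₗ[ℝ] ℝ :=
  -∑ y, LinearMap.proj y

theorem utilityFunctional_embed (φ : DirectScheme C Y) :
    utilityFunctional Y (I.embed φ) = I.advisorUtility φ := by
  simp only [utilityFunctional, embed, embedLinear, advisorUtility, LinearMap.neg_apply,
    LinearMap.sum_apply, LinearMap.proj_apply, LinearMap.coe_mk, AddHom.coe_mk,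
    Finset.sum_neg_distrib, neg_neg]
  exact Finset.sum_comm

theorem exists_isMaxOn_advisorUtility [Nonempty Y] :
    ∃ φ ∈ I.persuasiveSchemes, IsMaxOn I.advisorUtility I.persuasiveSchemes φ := by
  obtain ⟨_, ⟨φ, hφ, rfl⟩, hmax⟩ := I.isCompact_image_embed.exists_isMaxOn
    (I.persuasiveSchemes_nonempty.image _)
    (LinearMap.continuous_of_finiteDimensional (utilityFunctional Y)).continuousOn
  refine ⟨φ, hφ, fun ψ hψ => ?_⟩
  simpa only [Set.mem_ofPred_eq, utilityFunctional_embed] using hmax (Set.mem_image_of_mem _ hψ)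

end Decomposition

section RealizedUtility

variable {C Y : Type*} (I : PersuasionProblem C Y)

/-- The law of the utility `v(c, y)` realized in a round in which the scheme `φ` is used. -/
def realizedUtility (φ : DirectScheme C Y) : PMF ℝ :=
  I.prior.bind fun c => (φ c).map (I.v c)

variable {I} {B : ℝ} (hv : ∀ c y, |I.v c y| ≤ B)
include hv

theorem abs_le_of_mem_support_realizedUtility {φ : DirectScheme C Y} {r : ℝ}
    (hr : r ∈ (I.realizedUtility φ).support) : |r| ≤ B := by
  simp only [realizedUtility, PMF.mem_support_bind_iff, PMF.mem_support_map_iff] at hr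
  obtain ⟨c, _, y, _, rfl⟩ := hr
  exact hv c y

variable [Fintype C] [Fintype Y]

theorem pmfExpect_realizedUtility (φ : DirectScheme C Y) :
    pmfExpect (I.realizedUtility φ) id = I.advisorUtility φ := by
  have hb : BoundedOnSupport id (I.realizedUtility φ) :=
    ⟨B, fun _ => abs_le_of_mem_support_realizedUtility hv⟩
  have hitem : ∀ c ∈ I.prior.support,
      pmfExpect ((φ c).map (I.v c)) id = ∑ y, (φ c y).toReal * I.v c y := fun c hc => by
    rw [pmfExpect_map (hb.of_bind hc), pmfExpect_fintype]
    rfl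
  rw [realizedUtility, pmfExpect_bind hb, pmfExpect_congr hitem, pmfExpect_fintype]
  simp only [advisorUtility, Finset.mul_sum, mul_assoc]

theorem abs_advisorUtility_le (φ : DirectScheme C Y) : |I.advisorUtility φ| ≤ B := by
  rw [← pmfExpect_realizedUtility hv]
  exact abs_pmfExpect_le fun _ => abs_le_of_mem_support_realizedUtility hv

end RealizedUtility

section Run

variable {C Y : Type*} [Fintype C] [Fintype Y] {I : PersuasionProblem C Y}

theorem pmfExpect_weight_advisorUtility (D : I.Decomposition) (z : I.hull) :
    (pmfExpect (D.weight z) fun i => I.advisorUtility (D.scheme z i)) =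
      utilityFunctional Y (z : Y → ℝ) := by
  rw [pmfExpect_fintype]
  conv_rhs => rw [← D.combine z, map_sum]
  simp only [map_smul, smul_eq_mul, utilityFunctional_embed]

/-- The total expected utility `∑ₜ v(φₜ)` of the schemes used along a history. -/
def totalUtility (I : PersuasionProblem C Y) (h : List I.Round) : ℝ :=
  (h.map fun r => I.advisorUtility r.scheme).sum

theorem totalUtility_nil : I.totalUtility [] = 0 := by
  simp only [totalUtility, List.map_nil, List.sum_nil]

theorem totalUtility_cons (r : I.Round) (h : List I.Round) :
    I.totalUtility (r :: h) = I.advisorUtility r.scheme + I.totalUtility h := by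
  simp only [totalUtility, List.map_cons, List.sum_cons]

theorem regret_eq {φ : DirectScheme C Y} (hφ : φ ∈ I.persuasiveSchemes)
    (hmax : IsMaxOn I.advisorUtility I.persuasiveSchemes φ) (T : ℕ) (h : List I.Round) :
    I.regret T h = ∑ _t ∈ Finset.range T, I.advisorUtility φ - I.totalUtility h := by
  rw [regret, totalUtility, IsGreatest.csSup_eq ⟨Set.mem_image_of_mem _ hφ, ?_⟩]
  rintro _ ⟨ψ, hψ, rfl⟩
  exact Finset.sum_le_sum fun _ _ => hmax hψ

/-- The law of one round of the persuasion algorithm, given the history `h` so far. -/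
def roundLaw (R : Recommender I.hull) (D : I.Decomposition) (h : List I.Round) : PMF I.Round :=
  (R.recommend (I.observed h)).bind fun z => (D.weight z).bind fun i =>
    I.prior.bind fun c => ((D.scheme z i : DirectScheme C Y) c).map (Round.mk z (D.scheme z i) c)

theorem run_eq_historyLaw (R : Recommender I.hull) (D : I.Decomposition) (n : ℕ) :
    I.run R D n = historyLaw (fun _ => roundLaw R D) n := by
  induction n with
  | zero => rfl
  | succ n ih =>
    simp only [run, historyLaw, roundLaw, ih, PMF.map_bind, PMF.map_comp]
    rfl

theorem map_scheme_roundLaw (R : Recommender I.hull) (D : I.Decomposition) (h : List I.Round) :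
    (roundLaw R D h).map Round.scheme =
      (R.recommend (I.observed h)).bind fun z => (D.weight z).map (D.scheme z) := by
  have hconst : ∀ z φ c, (Round.scheme ∘ Round.mk z φ c : Y → I.persuasiveSchemes) =
      Function.const Y φ := fun _ _ _ => rfl
  simp only [roundLaw, PMF.map_bind, PMF.map_comp, hconst, PMF.map_const, PMF.bind_const]
  rfl

variable {B : ℝ} (hv : ∀ c y, |I.v c y| ≤ B)
include hv

theorem pmfExpect_roundLaw_advisorUtility (R : Recommender I.hull) (D : I.Decomposition)
    (h : List I.Round) :
    (pmfExpect (roundLaw R D h) fun r => I.advisorUtility r.scheme) =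
      pmfExpect (R.recommend (I.observed h)) fun z => utilityFunctional Y (z : Y → ℝ) := by
  have hb : ∀ p : PMF I.persuasiveSchemes,
      BoundedOnSupport (fun φ : I.persuasiveSchemes => I.advisorUtility φ) p :=
    fun _ => ⟨B, fun _ _ => abs_advisorUtility_le hv _⟩
  have hscheme := pmfExpect_map (hb ((roundLaw R D h).map Round.scheme))
  rw [← hscheme, map_scheme_roundLaw, pmfExpect_bind (hb _)]
  refine pmfExpect_congr fun z _ => ?_
  rw [pmfExpect_map (hb _), ← pmfExpect_weight_advisorUtility D]

/-- The bandit environment that the persuasion algorithm presents to its regret minimizer. -/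
def environment (D : I.Decomposition) : BanditEnvironment I.hull B where
  payoff _ := utilityFunctional Y
  feedback _ z := (D.weight z).bind fun i => I.realizedUtility (D.scheme z i)
  bounded _ z r hr := by
    obtain ⟨i, _, hi⟩ := (PMF.mem_support_bind_iff _ _ _).1 hr
    exact abs_le_of_mem_support_realizedUtility hv hi
  unbiased _ z := by
    rw [pmfExpect_bind, ← pmfExpect_weight_advisorUtility D]
    · simp only [pmfExpect_realizedUtility hv]
    · refine ⟨B, fun r hr => ?_⟩
      obtain ⟨i, _, hi⟩ := (PMF.mem_support_bind_iff _ _ _).1 hr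
      exact abs_le_of_mem_support_realizedUtility hv hi

variable (R : Recommender I.hull) (D : I.Decomposition)

theorem map_observed_run (n : ℕ) :
    (I.run R D n).map I.observed = (environment hv D).play R n := by
  rw [run_eq_historyLaw, BanditEnvironment.play_eq_historyLaw]
  refine historyLaw_map (fun r : I.Round => (r.point, I.v r.item r.response)) (fun t h => ?_) n
  simp only [roundLaw, feedbackLaw, environment, realizedUtility, PMF.map_bind, PMF.map_comp]
  rfl

theorem boundedOnSupport_totalUtility (n : ℕ) :
    BoundedOnSupport I.totalUtility (I.run R D n) := by
  rw [run_eq_historyLaw]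
  exact .additive (f := fun _ (r : I.Round) => I.advisorUtility r.scheme) totalUtility_nil
    (totalUtility_cons (I := I)) (fun _ r => abs_advisorUtility_le hv r.scheme) n

theorem pmfExpect_run_totalUtility (n : ℕ) :
    pmfExpect (I.run R D n) I.totalUtility =
      pmfExpect ((environment hv D).play R n) (environment hv D).cumPayoff := by
  induction n with
  | zero => simp only [run, BanditEnvironment.play, pmfExpect_pure, BanditEnvironment.cumPayoff,
      totalUtility_nil]
  | succ n ih =>
    have hpayoff : ∀ p : PMF (List (I.hull × ℝ)), BoundedOnSupport
        (fun h => pmfExpect (R.recommend h) fun z => (environment hv D).payoff n z) p :=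
      fun _ => ⟨B, fun h _ => abs_pmfExpect_le fun z _ => (environment hv D).abs_payoff_le n z⟩
    rw [BanditEnvironment.pmfExpect_cumPayoff_succ, ← ih, ← map_observed_run,
      pmfExpect_map (hpayoff _)]
    simp only [run_eq_historyLaw]
    rw [pmfExpect_additive_succ (f := fun _ (r : I.Round) => I.advisorUtility r.scheme)
      totalUtility_nil (totalUtility_cons (I := I)) fun _ r => abs_advisorUtility_le hv r.scheme]
    simp only [pmfExpect_roundLaw_advisorUtility hv]
    rfl

theorem expectedRegret_le {ρ : ℕ → ℝ} (hR : R.IsRegretMinimizer B ρ) {φ : DirectScheme C Y}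
    (hφ : φ ∈ I.persuasiveSchemes) (hmax : IsMaxOn I.advisorUtility I.persuasiveSchemes φ)
    {T : ℕ} (hT : 2 ≤ T) : I.expectedRegret R D T ≤ ρ T := by
  have hembed : I.embed φ ∈ I.hull := subset_convexHull ℝ _ (Set.mem_image_of_mem _ hφ)
  calc I.expectedRegret R D T
      = ∑ _t ∈ Finset.range T, I.advisorUtility φ -
          pmfExpect ((environment hv D).play R T) (environment hv D).cumPayoff := by
        rw [expectedRegret, funext (regret_eq hφ hmax T),
          pmfExpect_sub (.const _) (boundedOnSupport_totalUtility hv R D T), pmfExpect_const,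
          pmfExpect_run_totalUtility hv]
    _ = ∑ t ∈ Finset.range T, (environment hv D).payoff t (I.embed φ) -
          pmfExpect ((environment hv D).play R T) (environment hv D).cumPayoff := by
        simp only [environment, utilityFunctional_embed]
    _ ≤ ρ T := hR _ T hT _ hembed

end Run

end PersuasionProblem

theorem rpow_three_halves {x : ℝ} (hx : 0 < x) : x ^ (3 / 2 : ℝ) = x * √x := by
  rw [show (3 / 2 : ℝ) = 1 + 1 / 2 by norm_num, Real.rpow_add hx, Real.rpow_one,
    ← Real.sqrt_eq_rpow]

end

theorem theorem1 :
    ∃ K : ℝ, 0 < K ∧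
      ∀ (C Y : Type*) [Fintype C] [Fintype Y] [Nonempty Y] (I : PersuasionProblem C Y) (B : ℝ),
        (∀ c y, |I.v c y| ≤ B) →
        (∃ φ ∈ I.persuasiveSchemes, IsMaxOn I.advisorUtility I.persuasiveSchemes φ) ∧
        Nonempty I.Decomposition ∧
        ∃ R : Recommender I.hull,
          R.IsRegretMinimizer B (fun T : ℕ =>
            K * B * (Fintype.card Y : ℝ) ^ (3 / 2 : ℝ) * Real.sqrt (T * Real.log T)) ∧
          ∀ (D : I.Decomposition) (T : ℕ), 2 ≤ T →
            I.expectedRegret R D T ≤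
              K * B * (Fintype.card Y : ℝ) ^ (3 / 2 : ℝ) * Real.sqrt (T * Real.log T) := by
  refine ⟨50, by norm_num, fun C Y _ _ _ I B hv => ?_⟩
  obtain ⟨φ, hφ, hmax⟩ := I.exists_isMaxOn_advisorUtility
  have hB : 0 ≤ B := by
    obtain ⟨c, _⟩ := I.prior.support_nonempty
    exact (abs_nonneg _).trans (hv c (Classical.arbitrary Y))
  have hm : (1 : ℝ) ≤ Fintype.card Y := by exact_mod_cast Fintype.card_pos
  obtain ⟨R, hR⟩ := exists_isRegretMinimizer I.isCompact_hull I.hull_nonempty hm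
    (by rw [Module.finrank_fintype_fun_eq_card]) hB
  rw [← rpow_three_halves (by linarith)] at hR
  exact ⟨⟨φ, hφ, hmax⟩, I.nonempty_decomposition, R, hR, fun D T hT =>
    PersuasionProblem.expectedRegret_le hv R D hR hφ hmax hT⟩
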